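/- Let $\rho,n_2\ge 1$ and $n_1,d\ge 0$ be integers. Let $X$ be a random real matrix with $d$ columns and row blocks $X_1$ ($n_1$ rows) and $X_2$ ($n_2$ rows $x_1,\dots,x_{n_2}$, written as column vectors), with $X_1^TX_1$ almost surely nonsingular. Put $M_i=X_1^TX_1+\sum_{j\le i}x_jx_j^T$ for $0\le i\le n_2$, $t_i=|M_{i-1}|/|M_i|$ for $1\le i\le n_2$, and $\Omega=|X_1^TX_1|/|X^TX|$. If the rows of $X_1$ form an elemental set $E$ of $\rho$ out of $\ell$ observations, then $n_1=\rho$, $n_2=\ell-\rho$ and $\Omega=\omega_E$ is the elemental regression weight. For complex parameters and $z>0$ define the Meijer G-function by $$G^{m,n}_{p,q}\!\left(z\,\middle|\,{a_1,\dots,a_p\atop b_1,\dots,b_q}\right)=\frac1{2\pi i}\lim_{T\to\infty}\int_{c-iT}^{c+iT}z^{-s}\,\frac{\prod_{j=1}^m\Gamma(b_j+s)\prod_{j=1}^n\Gamma(1-a_j-s)}{\prod_{j=n+1}^p\Gamma(a_j+s)\prod_{j=m+1}^q\Gamma(1-b_j-s)}\,ds,$$ where the line $\mathrm{Re}\,s=c$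 has the poles of all $\Gamma(b_j+s)$, $j\le m$, on its left and those of all $\Gamma(1-a_j-s)$, $j\le n$, on its right. For $0<\omega<1$ let $$\sigma(\omega)=\left[\frac{\Gamma(\frac12(2\rho+0.5))}{\Gamma(\frac12(\rho+0.5))}\right]^{n_2}G^{n_2,0}_{n_2,n_2}\!\left(\omega\,\middle|\,{\frac12(2\rho-1.5),\dots,\frac12(2\rho-1.5)\atop\frac12(\rho-1.5),\dots,\frac12(\rho-1.5)}\right),$$ $$\Sigma(\omega)=\left[\frac{\Gamma(\frac12(2\rho+0.5))}{\Gamma(\frac12(\rho+0.5))}\right]^{n_2}G^{n_2,1}_{n_2+1,n_2+1}\!\left(\omega\,\middle|\,{1,\frac12(2\rho+0.5),\dots,\frac12(2\rho+0.5)\atop\frac12(\rho+0.5),\dots,\frac12(\rho+0.5),0}\right).$$ Then $\Omega=\prod_{i=1}^{n_2}t_i$ almost surely. For $0<\omega<1$ the two G-functions exist (the limit exists and is the same for every admissible $c$, and admissible $c$ exist) and are real; $\sigma\ge0$ on $(0,1)$, and $\sigma$ is integrable there. Write $\beta=\mathrm{Beta}\big(\frac12(\rho+0.5),\frac12\rho\big)$.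 Moreover: (a) If $t_1,\dots,t_{n_2}$ are independent and each has law $\beta$, then (i) $\Omega$ has the probability density $\sigma$ on $(0,1)$ (and $0$ elsewhere), and (ii) $P(\Omega\le\omega)=\Sigma(\omega)$ for all $0<\omega<1$. (b) If this holds approximately, in the sense that $|P((t_1,\dots,t_{n_2})\in A)-\beta^{\otimes n_2}(A)|\le\varepsilon$ for all Borel sets $A\subseteq\mathbb R^{n_2}$, then (i) $|P(\Omega\in B)-\int_{B\cap(0,1)}\sigma|\le\varepsilon$ for all Borel sets $B\subseteq\mathbb R$, and (ii) $|P(\Omega\le\omega)-\Sigma(\omega)|\le\varepsilon$ for all $0<\omega<1$. (c) If $t_1,\dots,t_{n_2}$ are independent with arbitrary laws, then $\Delta(F_\Omega,\Sigma)\le\sum_{i=1}^{n_2}\Delta(F_{t_i},F_\beta)$, where $F$ denotes a distribution function and $\Delta(F_1,F_2)=\frac12\int_0^1|F_1-F_2|$. -/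

import Mathlib

open MeasureTheory ProbabilityTheory Filter Topology Set Matrix

noncomputable section

namespace ElementalWeight

/-! ### The Meijer G-function as a Mellin-Barnes integral -/

/-- The integrand
`z ^ (-s) * ∏_{j ≤ m} Γ(b_j + s) * ∏_{j ≤ n} Γ(1 - a_j - s)
  / (∏_{n < j ≤ p} Γ(a_j + s) * ∏_{m < j ≤ q} Γ(1 - b_j - s))`
of the Meijer G-function `G^{m,n}_{p,q}(z | a_1, …, a_p; b_1, …, b_q)`. -/
def meijerIntegrand (m n : ℕ) {p q : ℕ} (a : Fin p → ℂ) (b : Fin q → ℂ) (z : ℝ) (s : ℂ) : ℂ :=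
  (z : ℂ) ^ (-s) *
    (((∏ j : Fin q with j.val < m, Complex.Gamma (b j + s)) *
        ∏ j : Fin p with j.val < n, Complex.Gamma (1 - a j - s)) /
      ((∏ j : Fin p with n ≤ j.val, Complex.Gamma (a j + s)) *
        ∏ j : Fin q with m ≤ j.val, Complex.Gamma (1 - b j - s)))

/-- The vertical line `Re s = c` has all poles of `Γ(b_j + s)`, `j ≤ m`, on its left and all poles
of `Γ(1 - a_j - s)`, `j ≤ n`, on its right. -/
def SeparatesPoles (m n : ℕ) {p q : ℕ} (a : Fin p → ℂ) (b : Fin q → ℂ) (c : ℝ) : Prop :=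
  (∀ j : Fin q, (j : ℕ) < m → -(b j).re < c) ∧ ∀ j : Fin p, (j : ℕ) < n → c < 1 - (a j).re

/-- `G^{m,n}_{p,q}(z | a; b)` exists and equals `g`: there is a separating vertical line, and along
each of them `(2 π i)⁻¹ ∫_{c - i T}^{c + i T}` of the integrand tends to `g` as `T → ∞`. -/
def HasMeijerG (m n : ℕ) {p q : ℕ} (a : Fin p → ℂ) (b : Fin q → ℂ) (z : ℝ) (g : ℂ) : Prop :=
  (∃ c : ℝ, SeparatesPoles m n a b c) ∧
    ∀ c : ℝ, SeparatesPoles m n a b c →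
      Tendsto (fun T : ℝ => (2 * (Real.pi : ℂ) * Complex.I)⁻¹ *
          ∫ t in (-T)..T, meijerIntegrand m n a b z ((c : ℂ) + (t : ℂ) * Complex.I) * Complex.I)
        atTop (𝓝 g)

open Classical in
/-- The Meijer G-function `G^{m,n}_{p,q}(z | a; b)` (with value `0` where it does not exist). -/
def meijerG (m n : ℕ) {p q : ℕ} (a : Fin p → ℂ) (b : Fin q → ℂ) (z : ℝ) : ℂ :=
  if h : ∃ g : ℂ, HasMeijerG m n a b z g then h.choose else 0

/-! ### The proposed density and distribution function -/

/-- The law `Beta((ρ + 0.5) / 2, ρ / 2)`. -/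
def factorLaw (ρ : ℕ) : Measure ℝ := betaMeasure (((ρ : ℝ) + 1 / 2) / 2) ((ρ : ℝ) / 2)

/-- `[Γ((2ρ + 0.5) / 2) / Γ((ρ + 0.5) / 2)] ^ n₂`. -/
def normConst (ρ n₂ : ℕ) : ℝ :=
  (Real.Gamma ((2 * (ρ : ℝ) + 1 / 2) / 2) / Real.Gamma (((ρ : ℝ) + 1 / 2) / 2)) ^ n₂

/-- Upper parameters `(2ρ - 1.5)/2, …, (2ρ - 1.5)/2` (`n₂` entries). -/
def densityUpper (ρ n₂ : ℕ) : Fin n₂ → ℂ := fun _ => (2 * (ρ : ℂ) - 3 / 2) / 2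

/-- Lower parameters `(ρ - 1.5)/2, …, (ρ - 1.5)/2` (`n₂` entries). -/
def densityLower (ρ n₂ : ℕ) : Fin n₂ → ℂ := fun _ => ((ρ : ℂ) - 3 / 2) / 2

/-- Upper parameters `1, (2ρ + 0.5)/2, …, (2ρ + 0.5)/2` (`n₂ + 1` entries). -/
def cdfUpper (ρ n₂ : ℕ) : Fin (n₂ + 1) → ℂ :=
  Fin.cons 1 fun _ : Fin n₂ => (2 * (ρ : ℂ) + 1 / 2) / 2

/-- Lower parameters `(ρ + 0.5)/2, …, (ρ + 0.5)/2, 0` (`n₂ + 1` entries). -/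
def cdfLower (ρ n₂ : ℕ) : Fin (n₂ + 1) → ℂ :=
  Fin.snoc (fun _ : Fin n₂ => ((ρ : ℂ) + 1 / 2) / 2) 0

/-- `G^{n₂,0}_{n₂,n₂}(ω | (2ρ - 1.5)/2, …, (2ρ - 1.5)/2; (ρ - 1.5)/2, …, (ρ - 1.5)/2)`. -/
def densityG (ρ n₂ : ℕ) (ω : ℝ) : ℂ := meijerG n₂ 0 (densityUpper ρ n₂) (densityLower ρ n₂) ω

/-- `G^{n₂,1}_{n₂+1,n₂+1}(ω | 1, (2ρ + 0.5)/2, …, (2ρ + 0.5)/2; (ρ + 0.5)/2, …, (ρ + 0.5)/2, 0)`.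
-/
def cdfG (ρ n₂ : ℕ) (ω : ℝ) : ℂ := meijerG n₂ 1 (cdfUpper ρ n₂) (cdfLower ρ n₂) ω

/-- The proposed density `σ` (the G-function is real on `(0, 1)`). -/
def weightDensity (ρ n₂ : ℕ) (ω : ℝ) : ℝ := normConst ρ n₂ * (densityG ρ n₂ ω).re

/-- The proposed distribution function `Σ` (the G-function is real on `(0, 1)`). -/
def weightCdf (ρ n₂ : ℕ) (ω : ℝ) : ℝ := normConst ρ n₂ * (cdfG ρ n₂ ω).re

/-- The distance `1/2 * ∫₀¹ |F₁ - F₂|` between distribution functions on `[0, 1]`. -/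
def cdfDist (F₁ F₂ : ℝ → ℝ) : ℝ := 1 / 2 * ∫ w in (0 : ℝ)..1, |F₁ w - F₂ w|

/-! ### The elemental regression weight and its factors -/

/-- `M_i = X₁ᵀ X₁ + ∑_{j ≤ i} x_j x_jᵀ`, where `x_1, …, x_{n₂}` are the rows of `X₂`. -/
def partialGram {n₁ n₂ d : ℕ} (X₁ : Matrix (Fin n₁) (Fin d) ℝ) (X₂ : Matrix (Fin n₂) (Fin d) ℝ)
    (i : ℕ) : Matrix (Fin d) (Fin d) ℝ :=
  X₁ᵀ * X₁ + ∑ j : Fin n₂ with j.val < i, Matrix.vecMulVec (X₂ j) (X₂ j)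

/-- The factor `t_{i+1} = |M_i| / |M_{i+1}|`, `i = 0, …, n₂ - 1`. -/
def factor {n₁ n₂ d : ℕ} (X₁ : Matrix (Fin n₁) (Fin d) ℝ) (X₂ : Matrix (Fin n₂) (Fin d) ℝ)
    (i : Fin n₂) : ℝ :=
  (partialGram X₁ X₂ (i : ℕ)).det / (partialGram X₁ X₂ ((i : ℕ) + 1)).det

/-- The weight `|X₁ᵀ X₁| / |Xᵀ X|` of the block `X₁` of the matrix `X` with row blocks
`X₁`, `X₂`. -/
def weight {n₁ n₂ d : ℕ} (X₁ : Matrix (Fin n₁) (Fin d) ℝ) (X₂ : Matrix (Fin n₂) (Fin d) ℝ) : ℝ :=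
  (X₁ᵀ * X₁).det / ((Matrix.fromRows X₁ X₂)ᵀ * Matrix.fromRows X₁ X₂).det

end ElementalWeight

end

/-! The Gram determinants telescope, so `Ω` is the product of the `t_i`, and each `t_i` lies in `(0,
1]` by the matrix determinant lemma (`weight_eq_prod_factor`, `factor_mem_Ioc`).

Put `a = (ρ + 1/2)/2` and `b = ρ/2`. For independent Beta(`a`, `b`) factors the moment of order `s`
of the product is the `n₂`-th power of a quotient of Gamma functions (`betaProduct_moment`). Up to
`normConst`, the Meijer integrands are `z ^ (-s)` times the Mellin transforms of the density and of
the distribution function: the former is the moment of order `s - 1`, the latter is `-1/s` times the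
moment of order `s` (`mellin_cdf`). Hence both G-functions are Mellin inversion integrals.

The inversion must hold at every point of `(0, 1)`, as a principal value and on every admissible
line. `tendsto_integral_mellin` provides this wherever the function is Lipschitz at the point. The
density is therefore built explicitly by iterated multiplicative convolution, as a power of `1 - x`
times a profile that is Lipschitz on every `[δ, 1]` (`lipschitzAway_betaProductProfile`,
`mconv_betaProductDensity`).

The approximate statement (b) pulls events for `Ω` back to events for the vector of factors.
Statement (c) exchanges one factor at a time: an independent factor in `(0, 1]` contracts the
distance of distribution functions (`cdfDist_mconv_le`, `cdfDist_prodLaw_le`). -/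

noncomputable section

namespace ElementalWeight

/-! ### Pointwise Fourier and Mellin inversion as principal values. -/

section

open scoped FourierTransform

/-- If `h` is integrable and Lipschitz at `0`, then `h 0` is the principal value integral of its
Fourier transform. -/
theorem tendsto_integral_fourier_zero {h : ℝ → ℂ} (hi : Integrable h)
    (hl : (fun u => h u - h 0) =O[𝓝 0] (fun u : ℝ => u)) :
    Tendsto (fun R : ℝ => ∫ ξ in (-R)..R, 𝓕 h ξ) atTop (𝓝 (h 0)) := by
  -- A Gaussian that is its own Fourier transform and has integral 1, so the claim holds for it.
  -- Subtracting `h 0 * G` leaves a function `k` with `k 0 = 0`.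
  set G : ℝ → ℂ := fun u => Complex.exp (-(Real.pi : ℂ) * (u : ℂ) ^ 2) with hG
  have hGi : Integrable G := by
    simpa [hG] using integrable_cexp_neg_mul_sq (b := (Real.pi : ℂ)) (by simpa using Real.pi_pos)
  have hGF : 𝓕 G = G := by
    have := fourier_gaussian_pi (b := 1) (by simp)
    simpa [hG] using this
  have hG1 : ∫ u, G u = 1 := by
    have := congrFun hGF 0
    rw [Real.fourier_eq'] at this
    simpa [hG] using this
  have hGl : (fun u => G u - G 0) =O[𝓝 0] (fun u : ℝ => u) := by
    have hd : DifferentiableAt ℝ G 0 := by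
      simp only [hG]
      fun_prop
    simpa using hd.isBigO_sub
  set k : ℝ → ℂ := fun u => h u - h 0 * G u with hk
  have hki : Integrable k := hi.sub (hGi.const_mul _)
  have hG0 : G 0 = 1 := by simp [hG]
  have hkl : k =O[𝓝 0] (fun u : ℝ => u) := by
    have := hl.sub (hGl.const_mul_left (h 0))
    refine this.congr_left fun u => ?_
    simp only [hk, hG0]
    ring
  -- Dividing by `u` is harmless: `k` is `O(u)` at `0`, and away from `0` the quotient is dominated
  -- by `‖k‖`. Integrating the exponential in `ξ` produces exactly this denominator, so the
  -- truncated integral of `𝓕 k` is a difference of two values of `𝓕 q`, which vanish at infinity by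
  -- Riemann-Lebesgue.
  set q : ℝ → ℂ := fun u => k u / (-2 * Real.pi * Complex.I * u) with hq
  have hqm : AEStronglyMeasurable q := by
    refine hki.aestronglyMeasurable.mul (Measurable.aestronglyMeasurable ?_)
    fun_prop
  have hqi : Integrable q := by
    obtain ⟨C, hC⟩ := hkl.bound
    obtain ⟨δ, hδ, hC⟩ := Metric.eventually_nhds_iff.1 hC
    have hb : Integrable (fun u => (2 * Real.pi * δ)⁻¹ * ‖k u‖ +
        (Ioo (-δ) δ).indicator (fun _ => |C|) u) := by
      refine (hki.norm.const_mul _).add ?_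
      rw [integrable_indicator_iff measurableSet_Ioo]
      exact integrableOn_const (by simp)
    refine hb.mono' hqm (Eventually.of_forall fun u => ?_)
    have hpi := Real.pi_gt_three
    have hn : ‖q u‖ = ‖k u‖ / (2 * Real.pi * |u|) := by
      simp [hq, abs_of_pos Real.pi_pos]
    rw [hn]
    by_cases hu : |u| < δ
    · have h1 : ‖k u‖ ≤ |C| * |u| := by
        refine (hC (by simpa using hu)).trans ?_
        rw [Real.norm_eq_abs]
        gcongr
        exact le_abs_self C
      have h2 : u ∈ Ioo (-δ) δ := abs_lt.1 hu
      rw [indicator_of_mem h2]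
      have h3 : ‖k u‖ / (2 * Real.pi * |u|) ≤ |C| := by
        rcases eq_or_ne u 0 with rfl | h0
        · simp
        · have : 0 < |u| := abs_pos.2 h0
          rw [div_le_iff₀ (by positivity)]
          nlinarith [mul_nonneg (abs_nonneg C) (abs_nonneg u)]
      have : 0 ≤ (2 * Real.pi * δ)⁻¹ * ‖k u‖ := by positivity
      linarith
    · rw [indicator_of_notMem (s := Ioo (-δ) δ) (fun h2 => hu (abs_lt.2 h2)), add_zero, div_eq_inv_mul]
      gcongr
      exact not_lt.1 hu
  have hRL := Real.zero_at_infty_fourier q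
  have hmain : ∀ R : ℝ, ∫ ξ in (-R)..R, 𝓕 k ξ = 𝓕 q R - 𝓕 q (-R) := by
    intro R
    have hsw : ∫ ξ in (-R)..R, 𝓕 k ξ =
        ∫ u, ∫ ξ in (-R)..R, Complex.exp (((-2 * Real.pi * (u * ξ) : ℝ) : ℂ) * Complex.I) • k u := by
      simp_rw [Real.fourier_eq']
      rw [intervalIntegral_integral_swap]
      · simp [mul_comm]
      · have : IsFiniteMeasure (volume.restrict (uIoc (-R) R)) := ⟨by simp [uIoc]⟩
        have h1 : Integrable (fun z : ℝ × ℝ => k z.2)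
            ((volume.restrict (uIoc (-R) R)).prod volume) := hki.comp_snd _
        refine h1.bdd_mul (c := 1) ?_ ?_
        · exact Continuous.aestronglyMeasurable (by fun_prop)
        · exact Eventually.of_forall fun z => by simp [Complex.norm_exp]
    have hex : ∀ R : ℝ, Integrable (fun u : ℝ =>
        Complex.exp (((-2 * Real.pi * (u * R) : ℝ) : ℂ) * Complex.I) • q u) := fun R => by
      refine hqi.bdd_mul (c := 1) (Continuous.aestronglyMeasurable (by fun_prop)) ?_
      exact Eventually.of_forall fun z => by simp [Complex.norm_exp]
    rw [hsw, Real.fourier_eq', Real.fourier_eq']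
    have e1 : ∀ R u : ℝ, inner ℝ u R = u * R := fun R u => by simp [mul_comm]
    simp_rw [e1]
    rw [← integral_sub (hex R) (hex (-R))]
    refine integral_congr_ae ?_
    filter_upwards [compl_mem_ae_iff.2 (measure_singleton (0 : ℝ))] with u hu
    have hu : u ≠ 0 := hu
    have hc : (-2 * Real.pi * u * Complex.I : ℂ) ≠ 0 := by
      simp [hu, Real.pi_ne_zero]
    have e2 : ∀ ξ : ℝ, Complex.exp (((-2 * Real.pi * (u * ξ) : ℝ) : ℂ) * Complex.I) • k u =
        Complex.exp ((-2 * Real.pi * u * Complex.I) * ξ) * k u := fun ξ => by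
      rw [smul_eq_mul]
      push_cast
      ring_nf
    simp_rw [e2]
    rw [intervalIntegral.integral_mul_const, integral_exp_mul_complex hc]
    simp only [hq, smul_eq_mul]
    push_cast
    field_simp
    ring_nf
  have hk0 : Tendsto (fun R : ℝ => ∫ ξ in (-R)..R, 𝓕 k ξ) atTop (𝓝 0) := by
    simp_rw [hmain]
    have h1 : Tendsto (fun R : ℝ => 𝓕 q R) atTop (𝓝 0) := hRL.mono_left atTop_le_cocompact
    have h2 : Tendsto (fun R : ℝ => 𝓕 q (-R)) atTop (𝓝 0) :=
      (hRL.mono_left atBot_le_cocompact).comp tendsto_neg_atTop_atBot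
    simpa using h1.sub h2
  have hGt : Tendsto (fun R : ℝ => ∫ ξ in (-R)..R, G ξ) atTop (𝓝 1) := by
    rw [← hG1]
    exact intervalIntegral_tendsto_integral hGi tendsto_neg_atTop_atBot tendsto_id
  have hsum : ∀ ξ, 𝓕 h ξ = 𝓕 k ξ + h 0 * G ξ := by
    intro ξ
    have e : h = k + h 0 • G := by
      ext u
      simp [hk]
    have hc : 𝓕 (h 0 • G) ξ = h 0 * G ξ := by
      conv_rhs => rw [← hGF]
      rw [Real.fourier_eq, Real.fourier_eq, ← integral_const_mul]
      refine integral_congr_ae (Eventually.of_forall fun u => ?_)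
      simp [Circle.smul_def, mul_left_comm]
    rw [← hc]
    conv_lhs => rw [e]
    rw [Real.fourier_eq, Real.fourier_eq, Real.fourier_eq, ← integral_add]
    · simp
    · exact (Real.fourierIntegral_convergent_iff ξ).2 hki
    · exact (Real.fourierIntegral_convergent_iff ξ).2 (hGi.smul (h 0))
  have hcont : Continuous (𝓕 k) :=
    VectorFourier.fourierIntegral_continuous Real.continuous_fourierChar
      (by exact continuous_inner) hki
  have hGc : Continuous G := by simp only [hG]; fun_prop
  have := hk0.add (hGt.const_mul (h 0))
  simp only [mul_one, zero_add] at this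
  refine this.congr fun R => ?_
  simp_rw [hsum]
  rw [intervalIntegral.integral_add (hcont.intervalIntegrable _ _)
    ((hGc.const_mul _).intervalIntegrable _ _), intervalIntegral.integral_const_mul]

/-- Principal value Fourier inversion at a point where the function is Lipschitz. -/
theorem tendsto_integral_fourier {h : ℝ → ℂ} (hi : Integrable h) (y : ℝ)
    (hl : (fun u => h u - h y) =O[𝓝 y] (fun u : ℝ => u - y)) :
    Tendsto (fun R : ℝ => ∫ ξ in (-R)..R, Complex.exp (2 * Real.pi * y * ξ * Complex.I) * 𝓕 h ξ)
      atTop (𝓝 (h y)) := by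
  have hi' : Integrable (fun u => h (u + y)) := hi.comp_add_right y
  have hl' : (fun u => h (u + y) - h (0 + y)) =O[𝓝 0] (fun u : ℝ => u) := by
    have ht : Tendsto (fun u : ℝ => u + y) (𝓝 0) (𝓝 y) := by
      have : Continuous fun u : ℝ => u + y := by fun_prop
      simpa using this.tendsto 0
    simpa [Function.comp_def] using hl.comp_tendsto ht
  have := tendsto_integral_fourier_zero (h := fun u => h (u + y)) hi' hl'
  simp only [zero_add] at this
  refine this.congr fun R => ?_
  congr 1
  ext ξ
  rw [Real.fourier_eq', Real.fourier_eq', ← integral_const_mul]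
  conv_rhs => rw [← integral_add_right_eq_self _ y]
  congr 1
  ext u
  rw [smul_eq_mul, smul_eq_mul, ← mul_assoc, ← Complex.exp_add]
  congr 2
  simp
  ring

/-- Principal value Mellin inversion at a point where the function is Lipschitz. -/
theorem tendsto_integral_mellin {f : ℝ → ℂ} {c ω : ℝ} (hω : 0 < ω)
    (hf : IntegrableOn (fun x : ℝ => ((x ^ (c - 1) : ℝ) : ℂ) * f x) (Ioi 0))
    (hl : (fun u => f u - f ω) =O[𝓝 ω] (fun u : ℝ => u - ω)) :
    Tendsto (fun T : ℝ => (2 * (Real.pi : ℂ) * Complex.I)⁻¹ *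
      ∫ t in (-T)..T, (ω : ℂ) ^ (-((c : ℂ) + t * Complex.I)) *
        mellin f ((c : ℂ) + t * Complex.I) * Complex.I) atTop (𝓝 (f ω)) := by
  -- The substitution `x = exp (-u)` turns the Mellin transform on `Re s = c` into the Fourier
  -- transform of `h`.
  set h : ℝ → ℂ := fun u => Real.exp (-c * u) • f (Real.exp (-u)) with hh
  have hi : Integrable h := by
    have himg : (fun u : ℝ => Real.exp (-u)) '' univ = Ioi 0 := by
      ext x
      constructor
      · rintro ⟨u, -, rfl⟩
        exact Real.exp_pos _
      · intro hx
        exact ⟨-Real.log x, trivial, by simp [Real.exp_log hx]⟩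
    rw [← himg, integrableOn_image_iff_integrableOn_abs_deriv_smul MeasurableSet.univ
      (f' := fun u => -Real.exp (-u))
      (fun u _ => by
        simpa using (hasDerivAt_neg u).exp)
      (fun u _ v _ huv => by simpa using huv), integrableOn_univ] at hf
    refine hf.congr (Eventually.of_forall fun u => ?_)
    simp only [hh, abs_neg, abs_of_pos (Real.exp_pos _), Complex.real_smul]
    rw [← Real.exp_mul, ← mul_assoc, ← Complex.ofReal_mul, ← Real.exp_add]
    ring_nf
  set y := -Real.log ω with hy
  have hey : Real.exp (-y) = ω := by simp [hy, Real.exp_log hω]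
  have hLip : (fun u => h u - h y) =O[𝓝 y] (fun u : ℝ => u - y) := by
    have hexp : DifferentiableAt ℝ (fun u : ℝ => Real.exp (-u)) y := by fun_prop
    have hexp' : DifferentiableAt ℝ (fun u : ℝ => Real.exp (-c * u)) y := by fun_prop
    have ht : Tendsto (fun u : ℝ => Real.exp (-u)) (𝓝 y) (𝓝 ω) := by
      simpa [hey] using hexp.continuousAt.tendsto
    have h1 : (fun u => f (Real.exp (-u)) - f ω) =O[𝓝 y] (fun u : ℝ => u - y) := by
      refine (hl.comp_tendsto ht).trans ?_
      have := hexp.isBigO_sub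
      simp only [hey] at this
      exact this
    have h2 : (fun u => Real.exp (-c * u) • (f (Real.exp (-u)) - f ω)) =O[𝓝 y]
        (fun u : ℝ => u - y) := by
      simpa using (hexp'.continuousAt.isBigO_one ℝ).smul h1
    have h3 : (fun u => (Real.exp (-c * u) - Real.exp (-c * y)) • f ω) =O[𝓝 y]
        (fun u : ℝ => u - y) := by
      have := hexp'.isBigO_sub.smul (Asymptotics.isBigO_const_const (f ω) (one_ne_zero (α := ℝ)) (𝓝 y))
      simpa using this
    refine (h2.add h3).congr_left fun u => ?_
    simp only [hh, hey]
    rw [smul_sub, sub_smul]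
    abel
  -- In `mellin_eq_fourier` the frequency is `Im s / (2π)`, so height `T` corresponds to the cutoff
  -- `T / (2π)`.
  have hR : Tendsto (fun T : ℝ => T / (2 * Real.pi)) atTop atTop :=
    tendsto_id.atTop_div_const (by positivity)
  have key := ((tendsto_integral_fourier hi y hLip).comp hR).const_mul ((ω : ℂ) ^ (-(c : ℂ)))
  have hω0 : (ω : ℂ) ≠ 0 := by simpa using hω.ne'
  have hval : (ω : ℂ) ^ (-(c : ℂ)) * h y = f ω := by
    have : Real.exp (-c * y) = ω ^ c := by
      rw [Real.rpow_def_of_pos hω, hy]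
      ring_nf
    simp only [hh, hey, this, Complex.real_smul]
    rw [← mul_assoc, Complex.ofReal_cpow hω.le, ← Complex.cpow_add _ _ hω0]
    simp
  rw [hval] at key
  refine key.congr fun T => ?_
  have hpi : (2 * Real.pi) ≠ 0 := by positivity
  have hsub := intervalIntegral.integral_comp_div (a := -T) (b := T)
    (fun ξ => Complex.exp (2 * Real.pi * y * ξ * Complex.I) * 𝓕 h ξ) hpi
  simp only [Function.comp_apply]
  rw [← neg_div, ← inv_smul_eq_iff₀ hpi] at *
  rw [← hsub]
  have hpt : ∀ t : ℝ, (ω : ℂ) ^ (-((c : ℂ) + t * Complex.I)) *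
      mellin f ((c : ℂ) + t * Complex.I) * Complex.I = (ω : ℂ) ^ (-(c : ℂ)) * Complex.I *
      (Complex.exp (2 * Real.pi * y * (t / (2 * Real.pi) : ℝ) * Complex.I) *
        𝓕 h (t / (2 * Real.pi))) := by
    intro t
    rw [mellin_eq_fourier, neg_add, Complex.cpow_add _ _ hω0]
    have e : (ω : ℂ) ^ (-(t * Complex.I)) =
        Complex.exp (2 * Real.pi * y * (t / (2 * Real.pi) : ℝ) * Complex.I) := by
      rw [Complex.cpow_def_of_ne_zero hω0, ← Complex.ofReal_log hω.le, hy]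
      congr 1
      push_cast
      field_simp
    rw [e]
    have e2 : ((c : ℂ) + t * Complex.I).re = c := by simp
    have e3 : ((c : ℂ) + t * Complex.I).im = t := by simp
    rw [e2, e3]
    ring
  simp_rw [hpt]
  rw [intervalIntegral.integral_const_mul, Complex.real_smul]
  have := Complex.I_ne_zero
  have hpc : (Real.pi : ℂ) ≠ 0 := by simp [Real.pi_ne_zero]
  push_cast
  field_simp
  simp_rw [mul_right_comm _ Complex.I]

end

section

/-! ### Gram determinants and their telescoping quotients. -/

section LinearAlgebra

variable {n₁ n₂ d : ℕ} (X₁ : Matrix (Fin n₁) (Fin d) ℝ) (X₂ : Matrix (Fin n₂) (Fin d) ℝ)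

theorem partialGram_zero : partialGram X₁ X₂ 0 = X₁ᵀ * X₁ := by
  simp [partialGram]

theorem partialGram_last :
    partialGram X₁ X₂ n₂ = (Matrix.fromRows X₁ X₂)ᵀ * Matrix.fromRows X₁ X₂ := by
  rw [Matrix.transpose_fromRows, Matrix.fromCols_mul_fromRows, partialGram]
  congr 1
  ext i j
  simp [Matrix.sum_apply, Matrix.mul_apply, vecMulVec_apply]

theorem partialGram_succ (i : Fin n₂) :
    partialGram X₁ X₂ (i + 1) = partialGram X₁ X₂ i + vecMulVec (X₂ i) (X₂ i) := by
  have : (Finset.univ.filter fun j : Fin n₂ => j.val < i + 1) =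
      insert i (Finset.univ.filter fun j : Fin n₂ => j.val < i) := by
    ext j
    simp [Fin.ext_iff]
    omega
  rw [partialGram, this, Finset.sum_insert (by simp), partialGram]
  abel

variable {X₁}

/-- A nonsingular Gram matrix is positive definite and stays so when positive semidefinite terms `x
xᵀ` are added. All determinants in the factors are thus positive. -/
theorem posDef_partialGram (h : (X₁ᵀ * X₁).det ≠ 0) (i : ℕ) : (partialGram X₁ X₂ i).PosDef := by
  have h0 : (X₁ᵀ * X₁).PosDef := by
    have hs : (X₁ᵀ * X₁).PosSemidef := by
      simpa using Matrix.posSemidef_conjTranspose_mul_self X₁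
    refine hs.posDef_iff_isUnit.2 ?_
    rw [Matrix.isUnit_iff_isUnit_det]
    exact isUnit_iff_ne_zero.2 h
  refine h0.add_posSemidef ?_
  refine Matrix.posSemidef_sum _ fun j _ => ?_
  simpa using posSemidef_vecMulVec_self_star (X₂ j)

/-- With `M` the current partial Gram matrix and `x` the next row, `|M + x xᵀ| = |M| (1 + xᵀ M⁻¹ x)`
and `xᵀ M⁻¹ x ≥ 0`. -/
theorem factor_mem_Ioc (h : (X₁ᵀ * X₁).det ≠ 0) (i : Fin n₂) : factor X₁ X₂ i ∈ Ioc (0 : ℝ) 1 := by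
  have h1 := posDef_partialGram X₂ h i
  have h2 := posDef_partialGram X₂ h (i + 1)
  refine ⟨div_pos h1.det_pos h2.det_pos, (div_le_one h2.det_pos).2 ?_⟩
  rw [partialGram_succ, vecMulVec_eq Unit,
    det_add_replicateCol_mul_replicateRow (isUnit_iff_ne_zero.2 h1.det_pos.ne')]
  have h3 := h1.inv.posSemidef.dotProduct_mulVec_nonneg (X₂ i)
  have h4 := h1.det_pos
  have h5 : (1 + replicateRow Unit (X₂ i) * (partialGram X₁ X₂ i)⁻¹ *
      replicateCol Unit (X₂ i)).det =
      1 + X₂ i ⬝ᵥ (partialGram X₁ X₂ i)⁻¹ *ᵥ X₂ i := by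
    rw [Matrix.det_unique, Matrix.mul_assoc]
    simp [Matrix.mul_apply, dotProduct, mulVec]
  rw [h5]
  simp only [star_trivial] at h3
  nlinarith

theorem weight_eq_prod_factor (h : (X₁ᵀ * X₁).det ≠ 0) :
    weight X₁ X₂ = ∏ i, factor X₁ X₂ i := by
  have h1 : ∀ i, (partialGram X₁ X₂ i).det ≠ 0 := fun i => (posDef_partialGram X₂ h i).det_pos.ne'
  have h2 : ∀ n, ∏ i ∈ Finset.range n,
      (partialGram X₁ X₂ i).det / (partialGram X₁ X₂ (i + 1)).det =
        (partialGram X₁ X₂ 0).det / (partialGram X₁ X₂ n).det := fun n => by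
    induction n with
    | zero => simp [h1]
    | succ n ih =>
      rw [Finset.prod_range_succ, ih]
      have := h1 n
      have := h1 (n + 1)
      field_simp
  rw [weight, ← partialGram_last, ← partialGram_zero X₁ X₂, ← h2, Finset.prod_range]
  rfl

end LinearAlgebra

/-! ### Measurability of the factors. -/

section Measurability

variable {S : Type*} [MeasurableSpace S]

theorem measurable_det {d : ℕ} {M : S → Matrix (Fin d) (Fin d) ℝ}
    (hM : ∀ i j, Measurable fun s => M s i j) : Measurable fun s => (M s).det := by
  simp_rw [Matrix.det_apply]
  exact Finset.measurable_sum _ fun σ _ =>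
    (Finset.measurable_prod _ fun i _ => hM _ _).const_smul _

theorem measurable_factor {n₁ n₂ d : ℕ} {X₁ : S → Matrix (Fin n₁) (Fin d) ℝ}
    {X₂ : S → Matrix (Fin n₂) (Fin d) ℝ}
    (hX₁ : ∀ i j, Measurable fun s => X₁ s i j) (hX₂ : ∀ i j, Measurable fun s => X₂ s i j)
    (i : Fin n₂) : Measurable fun s => factor (X₁ s) (X₂ s) i := by
  have h : ∀ k, Measurable fun s => (partialGram (X₁ s) (X₂ s) k).det := fun k => by
    refine measurable_det fun i j => ?_
    simp only [partialGram, Matrix.add_apply, Matrix.mul_apply, Matrix.sum_apply,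
      vecMulVec_apply, transpose_apply]
    fun_prop
  exact (h _).div (h _)

end Measurability

/-! ### Laws of products and the distance of distribution functions. -/

section DistributionFunctions

open scoped MeasureTheory

/-- The law of the product of independent variables with laws `μ i`. -/
def prodLaw {n : ℕ} (μ : Fin n → Measure ℝ) : Measure ℝ :=
  (Measure.pi μ).map fun x => ∏ i, x i

instance {n : ℕ} (μ : Fin n → Measure ℝ) [∀ i, IsProbabilityMeasure (μ i)] :
    IsProbabilityMeasure (prodLaw μ) :=
  Measure.isProbabilityMeasure_map (by fun_prop)

theorem prodLaw_zero (μ : Fin 0 → Measure ℝ) : prodLaw μ = Measure.dirac 1 := by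
  rw [prodLaw, Measure.pi_of_empty]
  simp

theorem prodLaw_succ {n : ℕ} (μ : Fin (n + 1) → Measure ℝ) [∀ i, IsProbabilityMeasure (μ i)] :
    prodLaw μ = μ 0 ∗ₘ prodLaw fun i : Fin n => μ i.succ := by
  have h := (measurePreserving_piFinSuccAbove μ 0).symm
  rw [prodLaw, ← h.map_eq, Measure.map_map (by fun_prop) (by fun_prop), prodLaw, Measure.mconv]
  conv_rhs => rw [← Measure.map_id (μ := μ 0)]
  rw [Measure.map_prod_map _ _ (by fun_prop) (by fun_prop),
    Measure.map_map (by fun_prop) (by fun_prop)]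
  congr 1
  ext x
  simp [Fin.prod_univ_succ, MeasurableEquiv.piFinSuccAbove_symm_apply, Fin.insertNthEquiv]

theorem ae_mem_Ioc_prodLaw {n : ℕ} (μ : Fin n → Measure ℝ) [∀ i, IsProbabilityMeasure (μ i)]
    (h : ∀ i, ∀ᵐ x ∂μ i, x ∈ Ioc (0 : ℝ) 1) : ∀ᵐ x ∂prodLaw μ, x ∈ Ioc (0 : ℝ) 1 := by
  rw [prodLaw]
  refine (ae_map_iff (by fun_prop) measurableSet_Ioc).2 ?_
  have : ∀ᵐ x ∂Measure.pi μ, ∀ i, x i ∈ Ioc (0 : ℝ) 1 :=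
    ae_all_iff.2 fun i => (measurePreserving_eval μ i).quasiMeasurePreserving.ae (h i)
  filter_upwards [this] with x hx
  exact ⟨Finset.prod_pos fun i _ => (hx i).1,
    Finset.prod_le_one (fun i _ => (hx i).1.le) fun i _ => (hx i).2⟩

theorem measurable_real_Iic (μ : Measure ℝ) [IsProbabilityMeasure μ] :
    Measurable fun w => μ.real (Iic w) :=
  (show Monotone fun w => μ.real (Iic w) from
    fun _ _ h => measureReal_mono (Iic_subset_Iic.2 h)).measurable

theorem abs_real_sub_real_le_one (μ ν : Measure ℝ) [IsProbabilityMeasure μ]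
    [IsProbabilityMeasure ν] (A B : Set ℝ) : |μ.real A - ν.real B| ≤ 1 := by
  have h1 : μ.real A ≤ 1 := measureReal_le_one
  have h2 : ν.real B ≤ 1 := measureReal_le_one
  have h3 : 0 ≤ μ.real A := measureReal_nonneg
  have h4 : 0 ≤ ν.real B := measureReal_nonneg
  rw [abs_le]
  constructor <;> linarith

theorem intervalIntegrable_abs_cdf_sub (μ ν : Measure ℝ) [IsProbabilityMeasure μ]
    [IsProbabilityMeasure ν] (x y : ℝ) :
    IntervalIntegrable (fun w => |μ.real (Iic w) - ν.real (Iic w)|) volume x y := by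
  refine (intervalIntegrable_const (c := (1 : ℝ))).mono_fun ?_ ?_
  · exact ((measurable_real_Iic μ).sub (measurable_real_Iic ν)).abs.aestronglyMeasurable
  · exact Eventually.of_forall fun w => by simpa using abs_real_sub_real_le_one μ ν _ _

/-- Condition on the first factor `x`: since `x > 0`, the event `x y ≤ w` is `y ≤ w / x`. -/
theorem real_mconv_Iic (μ ν : Measure ℝ) [IsProbabilityMeasure μ] [IsProbabilityMeasure ν]
    (h : ∀ᵐ x ∂μ, x ∈ Ioc (0 : ℝ) 1) (w : ℝ) :
    (μ ∗ₘ ν).real (Iic w) = ∫ x, ν.real (Iic (w / x)) ∂μ := by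
  have hm : MeasurableSet ((fun x : ℝ × ℝ => x.1 * x.2) ⁻¹' Iic w) :=
    measurableSet_Iic.preimage measurable_mul
  rw [Measure.mconv, map_measureReal_apply measurable_mul measurableSet_Iic,
    Measure.real, Measure.prod_apply hm,
    ← integral_toReal (measurable_measure_prodMk_left hm).aemeasurable
      (Eventually.of_forall fun x => measure_lt_top _ _)]
  refine integral_congr_ae ?_
  filter_upwards [h] with x hx
  rw [Measure.real]
  congr 2
  ext y
  simp [le_div_iff₀ hx.1, mul_comm]

/-- Multiplying by an independent factor in `(0, 1]` does not increase the distance. -/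
theorem cdfDist_mconv_le (μ ν₁ ν₂ : Measure ℝ) [IsProbabilityMeasure μ] [IsProbabilityMeasure ν₁]
    [IsProbabilityMeasure ν₂] (h : ∀ᵐ x ∂μ, x ∈ Ioc (0 : ℝ) 1)
    (h₁ : ∀ᵐ x ∂ν₁, x ∈ Ioc (0 : ℝ) 1) (h₂ : ∀ᵐ x ∂ν₂, x ∈ Ioc (0 : ℝ) 1) :
    cdfDist (fun w => (μ ∗ₘ ν₁).real (Iic w)) (fun w => (μ ∗ₘ ν₂).real (Iic w)) ≤
      cdfDist (fun w => ν₁.real (Iic w)) (fun w => ν₂.real (Iic w)) := by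
  set D : ℝ → ℝ := fun w => |ν₁.real (Iic w) - ν₂.real (Iic w)| with hD
  have hDm : Measurable D := ((measurable_real_Iic ν₁).sub (measurable_real_Iic ν₂)).abs
  have hD1 : ∀ w, |D w| ≤ 1 := fun w => by
    simpa [hD] using abs_real_sub_real_le_one ν₁ ν₂ (Iic w) (Iic w)
  have hintD : Integrable (fun z : ℝ × ℝ => D (z.1 / z.2))
      ((volume.restrict (Ioc 0 1)).prod μ) := by
    refine Integrable.of_bound (hDm.comp (measurable_fst.div measurable_snd)).aestronglyMeasurable 1
      (Eventually.of_forall fun z => hD1 _)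
  have hI : ∀ ν : Measure ℝ, IsProbabilityMeasure ν → ∀ w : ℝ,
      Integrable (fun x => ν.real (Iic (w / x))) μ := fun ν _ w => by
    refine Integrable.of_bound
      ((measurable_real_Iic ν).comp (measurable_const.div measurable_id)).aestronglyMeasurable 1
      (Eventually.of_forall fun z => ?_)
    rw [Real.norm_of_nonneg measureReal_nonneg]
    exact measureReal_le_one
  have hpt : ∀ w, |(μ ∗ₘ ν₁).real (Iic w) - (μ ∗ₘ ν₂).real (Iic w)| ≤ ∫ x, D (w / x) ∂μ := by
    intro w
    rw [real_mconv_Iic μ ν₁ h, real_mconv_Iic μ ν₂ h, ← integral_sub (hI ν₁ ‹_› w) (hI ν₂ ‹_› w)]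
    exact abs_integral_le_integral_abs
  -- Both distribution functions equal 1 from 1 on, so extending the integral of `D` to `[0, 1/x]`
  -- adds nothing.
  have hzero : ∀ w, 1 ≤ w → D w = 0 := fun w hw => by
    have : ∀ ν : Measure ℝ, IsProbabilityMeasure ν → (∀ᵐ x ∂ν, x ∈ Ioc (0 : ℝ) 1) →
        ν.real (Iic w) = 1 := fun ν _ hν => by
      have : ν (Iic w) = 1 := by
        rw [← mem_ae_iff_prob_eq_one measurableSet_Iic]
        filter_upwards [hν] with x hx using hx.2.trans hw
      simp [Measure.real, this]
    simp [hD, this ν₁ ‹_› h₁, this ν₂ ‹_› h₂]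
  have hDint : ∀ x y : ℝ, IntervalIntegrable D volume x y :=
    intervalIntegrable_abs_cdf_sub ν₁ ν₂
  -- The substitution `w ↦ w / x` yields the factor `x ≤ 1`; this is where the contraction comes
  -- from.
  have hscale : ∀ x ∈ Ioc (0 : ℝ) 1, ∫ w in (0 : ℝ)..1, D (w / x) ≤ ∫ w in (0 : ℝ)..1, D w := by
    intro x hx
    have h1 : (1 : ℝ) ≤ 1 / x := (one_le_div hx.1).2 hx.2
    rw [intervalIntegral.integral_comp_div _ hx.1.ne', zero_div,
      ← intervalIntegral.integral_add_adjacent_intervals (hDint 0 1) (hDint 1 (1 / x)),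
      intervalIntegral.integral_congr (a := 1) (b := 1 / x) (g := fun _ => (0 : ℝ))
        fun w hw => hzero w (by rw [uIcc_of_le h1] at hw; exact hw.1)]
    have h2 : 0 ≤ ∫ w in (0 : ℝ)..1, D w :=
      intervalIntegral.integral_nonneg zero_le_one fun w _ => abs_nonneg _
    simpa using mul_le_of_le_one_left h2 hx.2
  have hsw : ∫ w in (0 : ℝ)..1, ∫ x, D (w / x) ∂μ = ∫ x, (∫ w in (0 : ℝ)..1, D (w / x)) ∂μ := by
    simp_rw [intervalIntegral.integral_of_le zero_le_one]
    exact integral_integral_swap hintD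
  have hmc : ∀ ν : Measure ℝ, IsProbabilityMeasure ν → IsProbabilityMeasure (μ ∗ₘ ν) :=
    fun ν _ => Measure.isProbabilityMeasure_map (by fun_prop)
  have := hmc ν₁ ‹_›
  have := hmc ν₂ ‹_›
  have hle : ∫ w in (0 : ℝ)..1, |(μ ∗ₘ ν₁).real (Iic w) - (μ ∗ₘ ν₂).real (Iic w)| ≤
      ∫ w in (0 : ℝ)..1, D w := by
    calc _ ≤ ∫ w in (0 : ℝ)..1, ∫ x, D (w / x) ∂μ := by
          refine intervalIntegral.integral_mono_on zero_le_one
            (intervalIntegrable_abs_cdf_sub _ _ _ _) ?_ fun w _ => hpt w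
          rw [intervalIntegrable_iff_integrableOn_Ioc_of_le zero_le_one]
          exact hintD.integral_prod_left
      _ = ∫ x, (∫ w in (0 : ℝ)..1, D (w / x)) ∂μ := hsw
      _ ≤ ∫ _, (∫ w in (0 : ℝ)..1, D w) ∂μ := by
          refine integral_mono_ae ?_ (integrable_const _) ?_
          · simp_rw [intervalIntegral.integral_of_le zero_le_one]
            exact hintD.integral_prod_right
          · filter_upwards [h] with x hx using hscale x hx
      _ = ∫ w in (0 : ℝ)..1, D w := by simp
  simp only [cdfDist]
  gcongr

theorem cdfDist_triangle (μ₁ μ₂ μ₃ : Measure ℝ) [IsProbabilityMeasure μ₁]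
    [IsProbabilityMeasure μ₂] [IsProbabilityMeasure μ₃] :
    cdfDist (fun w => μ₁.real (Iic w)) (fun w => μ₃.real (Iic w)) ≤
      cdfDist (fun w => μ₁.real (Iic w)) (fun w => μ₂.real (Iic w)) +
      cdfDist (fun w => μ₂.real (Iic w)) (fun w => μ₃.real (Iic w)) := by
  simp only [cdfDist]
  rw [← mul_add, ← intervalIntegral.integral_add (intervalIntegrable_abs_cdf_sub _ _ _ _)
    (intervalIntegrable_abs_cdf_sub _ _ _ _)]
  gcongr
  exact intervalIntegral.integral_mono_on zero_le_one (intervalIntegrable_abs_cdf_sub _ _ _ _)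
    ((intervalIntegrable_abs_cdf_sub _ _ _ _).add (intervalIntegrable_abs_cdf_sub _ _ _ _))
    fun w _ => abs_sub_le _ _ _

/-- Exchange the factors one at a time. The intermediate law takes its first factor from `μ` and the
others from `ν`; the common part of two neighbouring products is dropped by `cdfDist_mconv_le`. -/
theorem cdfDist_prodLaw_le {n : ℕ} (μ ν : Fin n → Measure ℝ) [∀ i, IsProbabilityMeasure (μ i)]
    [∀ i, IsProbabilityMeasure (ν i)] (hμ : ∀ i, ∀ᵐ x ∂μ i, x ∈ Ioc (0 : ℝ) 1)
    (hν : ∀ i, ∀ᵐ x ∂ν i, x ∈ Ioc (0 : ℝ) 1) :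
    cdfDist (fun w => (prodLaw μ).real (Iic w)) (fun w => (prodLaw ν).real (Iic w)) ≤
      ∑ i, cdfDist (fun w => (μ i).real (Iic w)) (fun w => (ν i).real (Iic w)) := by
  induction n with
  | zero => simp [prodLaw_zero, cdfDist]
  | succ n ih =>
    have hμ' := ae_mem_Ioc_prodLaw _ fun i : Fin n => hμ i.succ
    have hν' := ae_mem_Ioc_prodLaw _ fun i : Fin n => hν i.succ
    rw [Fin.sum_univ_succ, prodLaw_succ, prodLaw_succ]
    have : IsProbabilityMeasure (μ 0 ∗ₘ prodLaw fun i : Fin n => ν i.succ) := by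
      exact Measure.isProbabilityMeasure_map (by fun_prop)
    have : IsProbabilityMeasure (μ 0 ∗ₘ prodLaw fun i : Fin n => μ i.succ) := by
      exact Measure.isProbabilityMeasure_map (by fun_prop)
    have : IsProbabilityMeasure (ν 0 ∗ₘ prodLaw fun i : Fin n => ν i.succ) := by
      exact Measure.isProbabilityMeasure_map (by fun_prop)
    refine (cdfDist_triangle _ (μ 0 ∗ₘ prodLaw fun i : Fin n => ν i.succ) _).trans ?_
    rw [add_comm]
    gcongr
    · rw [Measure.mconv_comm (μ 0), Measure.mconv_comm (ν 0)]
      exact cdfDist_mconv_le _ _ _ hν' (hμ 0) (hν 0)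
    · exact (cdfDist_mconv_le _ _ _ (hμ 0) hμ' hν').trans
        (ih _ _ (fun i => hμ i.succ) fun i => hν i.succ)

end DistributionFunctions

end

/-! ### The density of a product of independent beta variables. -/

section

open scoped MeasureTheory ENNReal

/-- `f` is Lipschitz on `[δ, 1]` for every `δ > 0`. -/
def LipschitzAway (f : ℝ → ℝ) : Prop :=
  ∀ δ : ℝ, 0 < δ → ∃ K : ℝ, 0 ≤ K ∧ ∀ x ∈ Icc δ 1, ∀ y ∈ Icc δ 1, |f x - f y| ≤ K * |x - y|

namespace LipschitzAway

variable {f g : ℝ → ℝ}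

theorem continuousOn (hf : LipschitzAway f) {δ : ℝ} (hδ : 0 < δ) : ContinuousOn f (Icc δ 1) := by
  obtain ⟨K, hK, h⟩ := hf δ hδ
  have : LipschitzOnWith K.toNNReal f (Icc δ 1) :=
    LipschitzOnWith.of_dist_le_mul fun x hx y hy => by
      simpa [Real.dist_eq, hK] using h x hx y hy
  exact this.continuousOn

theorem exists_bound (hf : LipschitzAway f) {δ : ℝ} (hδ : 0 < δ) :
    ∃ C : ℝ, 0 ≤ C ∧ ∀ x ∈ Icc δ 1, |f x| ≤ C := by
  obtain ⟨C, hC⟩ := isCompact_Icc.exists_bound_of_continuousOn (hf.continuousOn hδ)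
  exact ⟨|C|, abs_nonneg C, fun x hx => (hC x hx).trans (le_abs_self C)⟩

theorem mul (hf : LipschitzAway f) (hg : LipschitzAway g) :
    LipschitzAway fun x => f x * g x := by
  intro δ hδ
  obtain ⟨K, hK, hf'⟩ := hf δ hδ
  obtain ⟨L, hL, hg'⟩ := hg δ hδ
  obtain ⟨C, hC, hfC⟩ := hf.exists_bound hδ
  obtain ⟨D, hD, hgD⟩ := hg.exists_bound hδ
  refine ⟨C * L + K * D, by positivity, fun x hx y hy => ?_⟩
  calc |f x * g x - f y * g y| = |f x * (g x - g y) + (f x - f y) * g y| := by ring_nf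
    _ ≤ |f x| * |g x - g y| + |f x - f y| * |g y| := by
      rw [← abs_mul, ← abs_mul]
      exact abs_add_le _ _
    _ ≤ C * (L * |x - y|) + K * |x - y| * D := by
      gcongr
      exacts [hfC x hx, hg' x hx y hy, hf' x hx y hy, hgD y hy]
    _ = _ := by ring

theorem rpow (p : ℝ) : LipschitzAway fun x => x ^ p := by
  intro δ hδ
  have : ContDiffOn ℝ 1 (fun x : ℝ => x ^ p) (Icc δ 1) := fun x hx =>
    (Real.contDiffAt_rpow_const_of_ne (hδ.trans_le hx.1).ne').contDiffWithinAt
  obtain ⟨K, hK⟩ := this.exists_lipschitzOnWith one_ne_zero (convex_Icc _ _) isCompact_Icc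
  exact ⟨K, K.2, fun x hx y hy => by simpa [Real.dist_eq] using hK.dist_le_mul x hx y hy⟩

theorem const (c : ℝ) : LipschitzAway fun _ => c :=
  fun _ _ => ⟨0, le_rfl, fun x _ y _ => by simp⟩

/-- For `v` in `[0, 1]` the point `1 - (1 - x) v` runs over `[x, 1]`, reaching 1 at `v = 0`. Hence
the Lipschitz bounds must include the endpoint 1, though not 0. -/
theorem segment_mem {δ x v : ℝ} (hx : x ∈ Icc δ 1) (hv : v ∈ Icc (0 : ℝ) 1) :
    1 - (1 - x) * v ∈ Icc δ 1 := by
  obtain ⟨h1, h2⟩ := hx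
  obtain ⟨h3, h4⟩ := hv
  constructor <;> nlinarith

theorem intervalIntegrable_segment (hf : LipschitzAway f) {w : ℝ → ℝ}
    (hw : IntervalIntegrable w volume 0 1) {x : ℝ} (hx : x ∈ Ioc (0 : ℝ) 1) :
    IntervalIntegrable (fun v => w v * f (1 - (1 - x) * v)) volume 0 1 := by
  refine hw.mul_continuousOn ?_
  rw [uIcc_of_le zero_le_one]
  exact (hf.continuousOn hx.1).comp (by fun_prop) fun v hv => segment_mem ⟨le_rfl, hx.2⟩ hv

/-- The weight does not depend on `x` and may be singular at both ends. Only the argument of `f`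
moves, at rate `v ≤ 1`, so `K * ∫ |w|` is a Lipschitz constant. -/
theorem integral_segment (hf : LipschitzAway f) {w : ℝ → ℝ}
    (hw : IntervalIntegrable w volume 0 1) :
    LipschitzAway fun x => ∫ v in (0 : ℝ)..1, w v * f (1 - (1 - x) * v) := by
  intro δ hδ
  obtain ⟨K, hK, hf'⟩ := hf δ hδ
  refine ⟨K * ∫ v in (0 : ℝ)..1, |w v|,
    mul_nonneg hK (intervalIntegral.integral_nonneg zero_le_one fun _ _ => abs_nonneg _),
    fun x hx y hy => ?_⟩
  have ix := hf.intervalIntegrable_segment hw ⟨hδ.trans_le hx.1, hx.2⟩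
  have iy := hf.intervalIntegrable_segment hw ⟨hδ.trans_le hy.1, hy.2⟩
  rw [← intervalIntegral.integral_sub ix iy]
  refine (intervalIntegral.abs_integral_le_integral_abs zero_le_one).trans ?_
  rw [mul_right_comm, ← intervalIntegral.integral_const_mul]
  refine intervalIntegral.integral_mono_on zero_le_one (ix.sub iy).abs (hw.abs.const_mul _) ?_
  intro v hv
  rw [← mul_sub, abs_mul, mul_comm]
  gcongr
  refine (hf' _ (segment_mem hx hv) _ (segment_mem hy hv)).trans ?_
  refine mul_le_mul_of_nonneg_left ?_ hK
  have : 1 - (1 - x) * v - (1 - (1 - y) * v) = (x - y) * v := by ring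
  rw [this, abs_mul, abs_of_nonneg hv.1]
  exact mul_le_of_le_one_right (abs_nonneg _) hv.2

theorem isBigO_sub (hf : LipschitzAway f) {x : ℝ} (hx : x ∈ Ioo (0 : ℝ) 1) :
    (fun y => f y - f x) =O[𝓝 x] fun y => y - x := by
  obtain ⟨K, hK, h⟩ := hf (x / 2) (by linarith [hx.1])
  refine Asymptotics.IsBigO.of_bound K ?_
  have : Icc (x / 2) 1 ∈ 𝓝 x := Icc_mem_nhds (by linarith [hx.1]) hx.2
  filter_upwards [this] with y hy
  exact h y hy x ⟨by linarith [hx.1], hx.2.le⟩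

end LipschitzAway

theorem intervalIntegrable_beta {p q : ℝ} (hp : 0 < p) (hq : 0 < q) :
    IntervalIntegrable (fun v : ℝ => v ^ (p - 1) * (1 - v) ^ (q - 1)) volume 0 1 := by
  have h := (Complex.betaIntegral_convergent (u := p) (v := q) (by simpa) (by simpa)).norm
  rw [intervalIntegrable_iff_integrableOn_Ioo_of_le zero_le_one] at h ⊢
  refine h.congr_fun (fun v hv => ?_) measurableSet_Ioo
  have h1 : (1 - (v : ℂ)) = ((1 - v : ℝ) : ℂ) := by push_cast; rfl
  dsimp only
  rw [norm_mul, h1, Complex.norm_cpow_eq_rpow_re_of_pos hv.1,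
    Complex.norm_cpow_eq_rpow_re_of_pos (by linarith [hv.2])]
  simp

/-- The density of the product of `n + 1` independent `Beta(a, b)` variables, divided by
`(1 - x) ^ ((n + 1) b - 1)`. -/
def betaProductProfile (a b : ℝ) : ℕ → ℝ → ℝ
  | 0 => fun x => x ^ (a - 1) * (1 / beta a b)
  | n + 1 => fun x => x ^ (a - 1) * (1 / beta a b) *
      ∫ v in (0 : ℝ)..1, v ^ ((n + 1) * b - 1) * (1 - v) ^ (b - 1) *
        (betaProductProfile a b n (1 - (1 - x) * v) * (1 - (1 - x) * v) ^ (1 - a - b))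

/-- The density of the product of `n + 1` independent `Beta(a, b)` variables. -/
def betaProductDensity (a b : ℝ) (n : ℕ) : ℝ → ℝ :=
  (Ioo (0 : ℝ) 1).indicator fun x => (1 - x) ^ ((n + 1) * b - 1) * betaProductProfile a b n x

section

variable {a b : ℝ}

theorem lipschitzAway_betaProductProfile (hb : 0 < b) (n : ℕ) :
    LipschitzAway (betaProductProfile a b n) := by
  induction n with
  | zero => exact (LipschitzAway.rpow _).mul (LipschitzAway.const _)
  | succ n ih =>
    exact ((LipschitzAway.rpow _).mul (LipschitzAway.const _)).mul
      ((ih.mul (LipschitzAway.rpow _)).integral_segment (intervalIntegrable_beta (by positivity) hb))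

theorem betaProductProfile_nonneg (ha : 0 < a) (hb : 0 < b) (n : ℕ) {x : ℝ}
    (hx : x ∈ Ioc (0 : ℝ) 1) : 0 ≤ betaProductProfile a b n x := by
  have hB := beta_pos ha hb
  have h0 : 0 ≤ x ^ (a - 1) * (1 / beta a b) := by
    have := Real.rpow_nonneg hx.1.le (a - 1)
    positivity
  induction n generalizing x with
  | zero => exact h0
  | succ n ih =>
    refine mul_nonneg h0 (intervalIntegral.integral_nonneg zero_le_one fun v hv => ?_)
    have hm := LipschitzAway.segment_mem ⟨le_rfl, hx.2⟩ hv
    have hm0 : 0 < 1 - (1 - x) * v := hx.1.trans_le hm.1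
    have h1 := Real.rpow_nonneg hv.1 ((n + 1) * b - 1)
    have h2 := Real.rpow_nonneg (sub_nonneg.2 hv.2) (b - 1)
    have h3 := Real.rpow_nonneg hm0.le (1 - a - b)
    have h4 := ih ⟨hm0, hm.2⟩ (mul_nonneg (Real.rpow_nonneg hm0.le (a - 1))
      (one_div_pos.2 hB).le)
    positivity

theorem betaProductDensity_nonneg (ha : 0 < a) (hb : 0 < b) (n : ℕ) (x : ℝ) :
    0 ≤ betaProductDensity a b n x :=
  indicator_nonneg (fun x hx => mul_nonneg (Real.rpow_nonneg (by linarith [hx.2]) _)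
    (betaProductProfile_nonneg ha hb n ⟨hx.1, hx.2.le⟩)) x

/-- The power of `1 - x` can blow up at 1, but it is differentiable inside `(0, 1)`. This is the
local hypothesis of Mellin inversion. -/
theorem isBigO_betaProductDensity (hb : 0 < b) (n : ℕ) {x : ℝ} (hx : x ∈ Ioo (0 : ℝ) 1) :
    (fun y => betaProductDensity a b n y - betaProductDensity a b n x) =O[𝓝 x]
      fun y => y - x := by
  have hd : DifferentiableAt ℝ (fun y : ℝ => (1 - y) ^ ((n + 1) * b - 1)) x :=
    DifferentiableAt.rpow_const (by fun_prop) (Or.inl (by linarith [hx.2]))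
  have h1 := hd.isBigO_sub
  have h2 := (lipschitzAway_betaProductProfile (a := a) hb n).isBigO_sub hx
  have h3 := (hd.continuousAt.isBigO_one ℝ).mul h2
  have h4 := h1.mul (Asymptotics.isBigO_const_const (betaProductProfile a b n x)
    (one_ne_zero (α := ℝ)) (𝓝 x))
  simp only [one_mul, mul_one] at h3 h4
  refine (h3.add h4).congr' ?_ EventuallyEq.rfl
  filter_upwards [isOpen_Ioo.mem_nhds hx] with y hy
  rw [betaProductDensity, indicator_of_mem hx, indicator_of_mem hy]
  ring

theorem continuousOn_betaProductDensity (hb : 0 < b) (n : ℕ) :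
    ContinuousOn (betaProductDensity a b n) (Ioo 0 1) := by
  intro x hx
  have h := (isBigO_betaProductDensity (a := a) hb n hx).trans_tendsto
    (by simpa using (continuous_id.sub continuous_const).tendsto (f := fun y : ℝ => y - x) x)
  have h' := h.add_const (betaProductDensity a b n x)
  refine ContinuousAt.continuousWithinAt ?_
  simpa [ContinuousAt] using h'

theorem measurable_betaProductDensity (hb : 0 < b) (n : ℕ) :
    Measurable (betaProductDensity a b n) := by
  have h : betaProductDensity a b n = (Ioo (0 : ℝ) 1).piecewise (betaProductDensity a b n) 0 := by
    ext x
    by_cases hx : x ∈ Ioo (0 : ℝ) 1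
    · rw [piecewise_eq_of_mem _ _ _ hx]
    · rw [piecewise_eq_of_notMem _ _ _ hx, betaProductDensity, indicator_of_notMem hx]
      rfl
  rw [h]
  classical
  exact (continuousOn_betaProductDensity hb n).measurable_piecewise continuousOn_const
    measurableSet_Ioo

theorem betaProductDensity_zero : betaProductDensity a b 0 = betaPDFReal a b := by
  ext x
  by_cases hx : x ∈ Ioo (0 : ℝ) 1
  · rw [betaProductDensity, indicator_of_mem hx, betaPDFReal,
      if_pos (show 0 < x ∧ x < 1 from hx), betaProductProfile]
    norm_num
    ring
  · rw [betaProductDensity, indicator_of_notMem hx, betaPDFReal,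
      if_neg (show ¬(0 < x ∧ x < 1) from hx)]

theorem lintegral_eq_lintegral_segment {F : ℝ → ℝ≥0∞} (hF : Measurable F) {c : ℝ} (hc : 0 < c) :
    ∫⁻ t, F t = ENNReal.ofReal c * ∫⁻ v, F (1 - c * v) := by
  rw [← lintegral_sub_left_eq_self F 1]
  conv_lhs => rw [← Real.smul_map_volume_mul_left hc.ne']
  rw [lintegral_smul_measure, lintegral_map (by fun_prop) (by fun_prop), abs_of_pos hc, smul_eq_mul]

/-- In the convolution integral put `t = 1 - (1 - x) v`. Then `1 - t = (1 - x) v` and `1 - x/t = (1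
- x)(1 - v)/t`, so the powers of `1 - x`, with the Jacobian, combine to the exponent `(n + 2) b -
1`, and the powers of `t` to `1 - a - b`, as in `betaProductProfile`. -/
theorem lintegral_betaProductDensity_mul (ha : 0 < a) (hb : 0 < b) (n : ℕ) (x : ℝ) :
    ∫⁻ t, ENNReal.ofReal (betaProductDensity a b n t) *
      (ENNReal.ofReal (betaProductDensity a b 0 (x / t)) * ENNReal.ofReal t⁻¹) =
    ENNReal.ofReal (betaProductDensity a b (n + 1) x) := by
  have hB := beta_pos ha hb
  have hm := measurable_betaProductDensity (a := a) hb n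
  have hm0 := measurable_betaProductDensity (a := a) hb 0
  by_cases hx : x ∈ Ioo (0 : ℝ) 1
  · have hx1 : 0 < 1 - x := by linarith [hx.2]
    rw [lintegral_eq_lintegral_segment (by fun_prop) hx1]
    set W : ℝ → ℝ := fun v => v ^ ((n + 1) * b - 1) * (1 - v) ^ (b - 1) *
        (betaProductProfile a b n (1 - (1 - x) * v) * (1 - (1 - x) * v) ^ (1 - a - b)) with hW
    set C : ℝ := (1 - x) ^ ((n + 1) * b - 1) * (1 - x) ^ (b - 1) *
      (x ^ (a - 1) * (1 / beta a b)) with hC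
    have hC0 : 0 ≤ C := by
      have := Real.rpow_nonneg hx.1.le (a - 1)
      have := Real.rpow_nonneg hx1.le (b - 1)
      have := Real.rpow_nonneg hx1.le ((n + 1) * b - 1)
      positivity
    have hpt : ∀ v, ENNReal.ofReal (betaProductDensity a b n (1 - (1 - x) * v)) *
        (ENNReal.ofReal (betaProductDensity a b 0 (x / (1 - (1 - x) * v))) *
          ENNReal.ofReal (1 - (1 - x) * v)⁻¹) =
        (Ioo (0 : ℝ) 1).indicator (fun v => ENNReal.ofReal (C * W v)) v := by
      intro v
      by_cases hv : v ∈ Ioo (0 : ℝ) 1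
      · have ht := LipschitzAway.segment_mem (δ := x) ⟨le_rfl, hx.2.le⟩ ⟨hv.1.le, hv.2.le⟩
        have ht0 : 0 < 1 - (1 - x) * v := hx.1.trans_le ht.1
        have ht1 : 1 - (1 - x) * v < 1 := by nlinarith [mul_pos hx1 hv.1]
        have htx : x < 1 - (1 - x) * v := by nlinarith [mul_pos hx1 (sub_pos.2 hv.2)]
        rw [indicator_of_mem hv, ← ENNReal.ofReal_mul (betaProductDensity_nonneg ha hb _ _),
          ← ENNReal.ofReal_mul (betaProductDensity_nonneg ha hb _ _)]
        congr 1
        have hq : x / (1 - (1 - x) * v) ∈ Ioo (0 : ℝ) 1 := ⟨div_pos hx.1 ht0, (div_lt_one ht0).2 htx⟩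
        rw [betaProductDensity, betaProductDensity, indicator_of_mem hq,
          indicator_of_mem (s := Ioo 0 1) (mem_Ioo.2 ⟨ht0, ht1⟩)]
        simp only [betaProductProfile, hC, hW]
        set t := 1 - (1 - x) * v with htd
        have e1 : 1 - t = (1 - x) * v := by rw [htd]; ring
        have e2 : 1 - x / t = (1 - x) * (1 - v) / t := by
          field_simp
          rw [htd]; ring
        have e3 : t ^ (1 - a - b) = (t ^ (a - 1))⁻¹ * (t ^ (b - 1))⁻¹ * t⁻¹ := by
          rw [← Real.rpow_neg ht0.le, ← Real.rpow_neg ht0.le, ← Real.rpow_add ht0,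
            ← Real.rpow_neg_one t, ← Real.rpow_add ht0]
          ring_nf
        have e4 : ((0 : ℕ) + 1) * b - 1 = b - 1 := by simp
        have hv1 : 0 ≤ 1 - v := by linarith [hv.2]
        rw [e1, e2, e3, e4, Real.mul_rpow hx1.le hv.1.le, Real.div_rpow (by positivity) ht0.le,
          Real.div_rpow hx.1.le ht0.le, Real.mul_rpow hx1.le hv1]
        ring
      · rw [indicator_of_notMem hv]
        rcases not_and_or.1 hv with hv | hv
        · have : (1 - (1 - x) * v) ∉ Ioo (0 : ℝ) 1 := fun h => hv (by nlinarith [h.2])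
          rw [betaProductDensity, indicator_of_notMem this]
          simp
        · by_cases ht0 : 0 < 1 - (1 - x) * v
          · have : x / (1 - (1 - x) * v) ∉ Ioo (0 : ℝ) 1 := fun h => hv (by
              have := (div_lt_one ht0).1 h.2
              nlinarith)
            rw [betaProductDensity, betaProductDensity, indicator_of_notMem this]
            simp
          · have : (1 - (1 - x) * v) ∉ Ioo (0 : ℝ) 1 := fun h => ht0 h.1
            rw [betaProductDensity, indicator_of_notMem this]
            simp
    simp_rw [hpt]
    rw [lintegral_indicator measurableSet_Ioo]
    have hWi : IntegrableOn W (Ioo 0 1) := by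
      rw [← intervalIntegrable_iff_integrableOn_Ioo_of_le zero_le_one]
      exact ((lipschitzAway_betaProductProfile hb n).mul
        (LipschitzAway.rpow _)).intervalIntegrable_segment
          (intervalIntegrable_beta (by positivity) hb) ⟨hx.1, hx.2.le⟩
    have hW0 : ∀ v ∈ Ioo (0 : ℝ) 1, 0 ≤ W v := fun v hv => by
      have ht := LipschitzAway.segment_mem (δ := x) ⟨le_rfl, hx.2.le⟩ ⟨hv.1.le, hv.2.le⟩
      have ht0 : 0 < 1 - (1 - x) * v := hx.1.trans_le ht.1
      have h1 := Real.rpow_nonneg hv.1.le ((n + 1) * b - 1)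
      have h2 := Real.rpow_nonneg (sub_nonneg.2 hv.2.le) (b - 1)
      have h3 := Real.rpow_nonneg ht0.le (1 - a - b)
      have h4 := betaProductProfile_nonneg ha hb n ⟨ht0, ht.2⟩
      positivity
    rw [← ofReal_integral_eq_lintegral_ofReal (hWi.const_mul C)
      ((ae_restrict_iff' measurableSet_Ioo).2 (Eventually.of_forall fun v hv =>
        mul_nonneg hC0 (hW0 v hv))), ← ENNReal.ofReal_mul hx1.le, integral_const_mul,
      ← integral_Ioc_eq_integral_Ioo, ← intervalIntegral.integral_of_le zero_le_one,
      betaProductDensity, indicator_of_mem hx, betaProductProfile]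
    congr 1
    have e : (1 - x) ^ (((n + 1 : ℕ) + 1) * b - 1) =
        (1 - x) * ((1 - x) ^ ((n + 1) * b - 1) * (1 - x) ^ (b - 1)) := by
      rw [← Real.rpow_add hx1]
      nth_rw 2 [← Real.rpow_one (1 - x)]
      rw [← Real.rpow_add hx1]
      push_cast
      ring_nf
    rw [e, hC]
    ring
  -- If `t` and `x / t` both lie in `(0, 1)`, then so does `x`.
  · have hz : ∀ t, betaProductDensity a b n t = 0 ∨ betaProductDensity a b 0 (x / t) = 0 := by
      intro t
      by_contra! h
      have h1 := mem_of_indicator_ne_zero h.1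
      have h2 := mem_of_indicator_ne_zero h.2
      refine hx ⟨?_, ?_⟩
      · have := h2.1
        rwa [lt_div_iff₀ h1.1, zero_mul] at this
      · have := (div_lt_one h1.1).1 h2.2
        exact this.trans h1.2
    rw [betaProductDensity.eq_def _ _ (n + 1), indicator_of_notMem hx]
    rw [ENNReal.ofReal_zero]
    refine lintegral_eq_zero_of_ae_eq_zero (Eventually.of_forall fun t => ?_)
    rcases hz t with h | h <;> simp [h]

theorem betaMeasure_eq_withDensity :
    betaMeasure a b = volume.withDensity fun x => ENNReal.ofReal (betaProductDensity a b 0 x) := by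
  rw [betaProductDensity_zero]
  rfl

/-- Test against indicators, substitute `x = t y` for fixed `t` in `(0, 1)`, and exchange the
integrals by Tonelli. -/
theorem mconv_betaProductDensity (ha : 0 < a) (hb : 0 < b) (n : ℕ) :
    (volume.withDensity fun x => ENNReal.ofReal (betaProductDensity a b n x)) ∗ₘ betaMeasure a b =
      volume.withDensity fun x => ENNReal.ofReal (betaProductDensity a b (n + 1) x) := by
  have hm := fun n => (measurable_betaProductDensity (a := a) hb n)
  rw [betaMeasure_eq_withDensity]
  ext B hB
  have hBm : Measurable (B.indicator (1 : ℝ → ℝ≥0∞)) := measurable_one.indicator hB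
  rw [← lintegral_indicator_one hB, Measure.lintegral_mconv hBm,
    lintegral_withDensity_eq_lintegral_mul _ (by fun_prop)]
  swap
  · exact Measurable.lintegral_prod_right (by fun_prop)
  have hin : ∀ t, ENNReal.ofReal (betaProductDensity a b n t) *
      ∫⁻ y, B.indicator 1 (t * y)
        ∂(volume.withDensity fun x => ENNReal.ofReal (betaProductDensity a b 0 x)) =
      ∫⁻ x, B.indicator 1 x * (ENNReal.ofReal (betaProductDensity a b n t) *
      (ENNReal.ofReal (betaProductDensity a b 0 (x / t)) * ENNReal.ofReal t⁻¹)) := by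
    intro t
    by_cases ht : t ∈ Ioo (0 : ℝ) 1
    · rw [lintegral_withDensity_eq_lintegral_mul _ (by fun_prop) (by fun_prop),
        ← lintegral_const_mul _ (by fun_prop)]
      have h0 : t ≠ 0 := ht.1.ne'
      conv_rhs => rw [← Real.smul_map_volume_mul_left h0]
      rw [lintegral_smul_measure, lintegral_map (by fun_prop) (by fun_prop), smul_eq_mul,
        ← lintegral_const_mul _ (by fun_prop)]
      refine lintegral_congr fun y => ?_
      have e : ENNReal.ofReal |t| * ENNReal.ofReal t⁻¹ = 1 := by
        rw [abs_of_pos ht.1, ← ENNReal.ofReal_mul ht.1.le, mul_inv_cancel₀ h0, ENNReal.ofReal_one]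
      rw [mul_div_cancel_left₀ _ h0, Pi.mul_apply]
      calc _ = (ENNReal.ofReal |t| * ENNReal.ofReal t⁻¹) *
            (ENNReal.ofReal (betaProductDensity a b n t) *
              (ENNReal.ofReal (betaProductDensity a b 0 y) * B.indicator 1 (t * y))) := by
            rw [e, one_mul]
        _ = _ := by ring
    · rw [betaProductDensity, indicator_of_notMem ht]
      simp
  simp only [Pi.mul_apply]
  simp_rw [hin]
  rw [lintegral_lintegral_swap (by fun_prop), withDensity_apply _ hB, ← lintegral_indicator hB]
  refine lintegral_congr fun x => ?_
  rw [lintegral_const_mul _ (by fun_prop), lintegral_betaProductDensity_mul ha hb]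
  by_cases hx : x ∈ B <;> simp [hx]

theorem prodLaw_betaMeasure (ha : 0 < a) (hb : 0 < b) (n : ℕ) :
    prodLaw (fun _ : Fin (n + 1) => betaMeasure a b) =
      volume.withDensity fun x => ENNReal.ofReal (betaProductDensity a b n x) := by
  have := isProbabilityMeasureBeta ha hb
  induction n with
  | zero =>
    rw [prodLaw_succ, prodLaw_zero, Measure.mconv_dirac_one, betaMeasure_eq_withDensity]
  | succ n ih =>
    rw [prodLaw_succ, ih, Measure.mconv_comm, mconv_betaProductDensity ha hb]

end

end

/-! ### Moments, Mellin transforms and their inversion. -/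

section

open scoped MeasureTheory ENNReal

theorem cpow_finset_prod {ι : Type*} (t : Finset ι) {x : ι → ℝ} (hx : ∀ i ∈ t, 0 ≤ x i) (s : ℂ) :
    ((∏ i ∈ t, x i : ℝ) : ℂ) ^ s = ∏ i ∈ t, (x i : ℂ) ^ s := by
  classical
  induction t using Finset.induction_on with
  | empty => simp
  | insert i t hi ih =>
    rw [Finset.prod_insert hi, Finset.prod_insert hi, Complex.ofReal_mul,
      Complex.mul_cpow_ofReal_nonneg (hx i (by simp))
        (Finset.prod_nonneg fun j hj => hx j (by simp [hj])),
      ih fun j hj => hx j (by simp [hj])]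

section WithDensity

variable {f : ℝ → ℝ} {E : Type*} [NormedAddCommGroup E] [NormedSpace ℝ E]

theorem integrable_withDensity_ofReal (hf : Measurable f) (h0 : ∀ x, 0 ≤ f x) {g : ℝ → E} :
    Integrable g (volume.withDensity fun x => ENNReal.ofReal (f x)) ↔
      Integrable fun x => f x • g x := by
  rw [integrable_withDensity_iff_integrable_smul' (by fun_prop) (by simp)]
  simp [ENNReal.toReal_ofReal, h0]

theorem integral_withDensity_ofReal (hf : Measurable f) (h0 : ∀ x, 0 ≤ f x) (g : ℝ → E) :
    ∫ x, g x ∂(volume.withDensity fun x => ENNReal.ofReal (f x)) = ∫ x, f x • g x := by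
  rw [integral_withDensity_eq_integral_toReal_smul (by fun_prop) (by simp)]
  simp [ENNReal.toReal_ofReal, h0]

end WithDensity

/-- The moment `E[t ^ s]` of a `Beta(a, b)` variable `t`. -/
def betaMoment (a b : ℝ) (s : ℂ) : ℂ :=
  (Complex.Gamma (a + s) / Complex.Gamma (a + b + s)) *
    (Complex.Gamma (a + b) / Complex.Gamma a)

variable {a b : ℝ}

/-- Multiplying the density by `x ^ s` shifts the shape `a` to `a + s`, which leaves a beta integral
converging for `Re (a + s) > 0`. -/
theorem betaMeasure_moment (ha : 0 < a) (hb : 0 < b) {s : ℂ} (hs : -a < s.re) :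
    Integrable (fun x : ℝ => (x : ℂ) ^ s) (betaMeasure a b) ∧
      ∫ x, (x : ℂ) ^ s ∂betaMeasure a b = betaMoment a b s := by
  have hm := measurable_betaProductDensity (a := a) hb 0
  have h0 := betaProductDensity_nonneg ha hb 0
  have hu : 0 < ((a : ℂ) + s).re := by simp; linarith
  have hB := beta_pos ha hb
  have hconv := Complex.betaIntegral_convergent (u := a + s) (v := b) hu (by simpa)
  rw [intervalIntegrable_iff_integrableOn_Ioo_of_le zero_le_one] at hconv
  have hpt : (fun x : ℝ => betaProductDensity a b 0 x • (x : ℂ) ^ s) =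
      (Ioo (0 : ℝ) 1).indicator fun x : ℝ => (1 / beta a b : ℂ) *
        ((x : ℂ) ^ ((a : ℂ) + s - 1) * (1 - (x : ℂ)) ^ ((b : ℂ) - 1)) := by
    ext x
    by_cases hx : x ∈ Ioo (0 : ℝ) 1
    · have hx0 : (x : ℂ) ≠ 0 := by simpa using hx.1.ne'
      rw [betaProductDensity_zero, betaPDFReal, if_pos (show 0 < x ∧ x < 1 from hx),
        indicator_of_mem hx, show (a : ℂ) + s - 1 = (a - 1 : ℝ) + s by push_cast; ring,
        Complex.cpow_add _ _ hx0, Complex.real_smul, ← Complex.ofReal_cpow hx.1.le]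
      push_cast
      rw [Complex.ofReal_cpow (sub_nonneg.2 hx.2.le)]
      push_cast
      ring
    · rw [betaProductDensity, indicator_of_notMem hx, indicator_of_notMem hx]
      simp
  rw [betaMeasure_eq_withDensity, integrable_withDensity_ofReal hm h0,
    integral_withDensity_ofReal hm h0, hpt]
  refine ⟨(integrable_indicator_iff measurableSet_Ioo).2 (hconv.const_mul _), ?_⟩
  rw [integral_indicator measurableSet_Ioo, integral_const_mul, ← integral_Ioc_eq_integral_Ioo,
    ← intervalIntegral.integral_of_le zero_le_one]
  have := Complex.betaIntegral_eq_Gamma_mul_div (a + s) b hu (by simpa)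
  rw [Complex.betaIntegral] at this
  rw [this, betaMoment, beta]
  have h1 := (Real.Gamma_pos_of_pos ha).ne'
  have h2 := (Real.Gamma_pos_of_pos hb).ne'
  have h3 := (Real.Gamma_pos_of_pos (add_pos ha hb)).ne'
  have h4 : Complex.Gamma (a + b + s) ≠ 0 :=
    Complex.Gamma_ne_zero_of_re_pos (by simp; linarith)
  have h5 : (a : ℂ) + s + b = a + b + s := by ring
  rw [h5]
  have h1' : Complex.Gamma a ≠ 0 := by rw [Complex.Gamma_ofReal]; simpa using h1
  have h2' : Complex.Gamma b ≠ 0 := by rw [Complex.Gamma_ofReal]; simpa using h2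
  have h3' : Complex.Gamma (a + b) ≠ 0 := by
    rw [← Complex.ofReal_add, Complex.Gamma_ofReal]; simpa using h3
  push_cast
  simp_rw [← Complex.Gamma_ofReal]
  push_cast
  field_simp

theorem ae_mem_Ioc_betaMeasure (hb : 0 < b) :
    ∀ᵐ x ∂betaMeasure a b, x ∈ Ioc (0 : ℝ) 1 := by
  have hm := measurable_betaProductDensity (a := a) hb 0
  rw [betaMeasure_eq_withDensity, ae_withDensity_iff (by fun_prop)]
  refine Eventually.of_forall fun x hx => ?_
  have h : betaProductDensity a b 0 x ≠ 0 := fun h => hx (by simp [h])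
  exact Ioo_subset_Ioc_self (mem_of_indicator_ne_zero h)

/-- The law of the product of `n` independent `Beta(a, b)` variables. -/
def betaProduct (a b : ℝ) (n : ℕ) : Measure ℝ := prodLaw fun _ : Fin n => betaMeasure a b

theorem isProbabilityMeasure_betaProduct (ha : 0 < a) (hb : 0 < b) (n : ℕ) :
    IsProbabilityMeasure (betaProduct a b n) := by
  have := isProbabilityMeasureBeta ha hb
  rw [betaProduct]
  infer_instance

theorem ae_mem_Ioc_betaProduct (ha : 0 < a) (hb : 0 < b) (n : ℕ) :
    ∀ᵐ x ∂betaProduct a b n, x ∈ Ioc (0 : ℝ) 1 := by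
  have := isProbabilityMeasureBeta ha hb
  exact ae_mem_Ioc_prodLaw _ fun _ => ae_mem_Ioc_betaMeasure hb

/-- On positive reals `x ↦ x ^ s` is multiplicative, so independence factors the moment. -/
theorem betaProduct_moment (ha : 0 < a) (hb : 0 < b) (n : ℕ) {s : ℂ} (hs : -a < s.re) :
    Integrable (fun x : ℝ => (x : ℂ) ^ s) (betaProduct a b n) ∧
      ∫ x, (x : ℂ) ^ s ∂betaProduct a b n = betaMoment a b s ^ n := by
  have := isProbabilityMeasureBeta ha hb
  have hpos : ∀ᵐ x ∂Measure.pi fun _ : Fin n => betaMeasure a b, ∀ i, x i ∈ Ioc (0 : ℝ) 1 :=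
    ae_all_iff.2 fun i => (measurePreserving_eval (fun _ : Fin n => betaMeasure a b)
      i).quasiMeasurePreserving.ae (ae_mem_Ioc_betaMeasure hb)
  have heq : (fun x : Fin n → ℝ => ∏ i, (x i : ℂ) ^ s) =ᵐ[Measure.pi fun _ => betaMeasure a b]
      fun x => ((∏ i, x i : ℝ) : ℂ) ^ s := by
    filter_upwards [hpos] with x hx
    rw [cpow_finset_prod _ fun i _ => (hx i).1.le]
  have hmeas : Measurable fun x : ℝ => (x : ℂ) ^ s := by fun_prop
  rw [betaProduct, prodLaw, integrable_map_measure hmeas.aestronglyMeasurable (by fun_prop),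
    integral_map (by fun_prop) hmeas.aestronglyMeasurable]
  constructor
  · exact (Integrable.fintype_prod (f := fun (_ : Fin n) (x : ℝ) => (x : ℂ) ^ s)
      fun _ => (betaMeasure_moment ha hb hs).1).congr heq
  · rw [← integral_congr_ae heq, integral_fintype_prod_eq_prod (f := fun (_ : Fin n) (x : ℝ) =>
      (x : ℂ) ^ s), (betaMeasure_moment ha hb hs).2]
    simp

theorem betaProduct_succ (ha : 0 < a) (hb : 0 < b) (n : ℕ) :
    betaProduct a b (n + 1) =
      volume.withDensity fun x => ENNReal.ofReal (betaProductDensity a b n x) :=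
  prodLaw_betaMeasure ha hb n

theorem integrable_betaProductDensity (ha : 0 < a) (hb : 0 < b) (n : ℕ) :
    Integrable (betaProductDensity a b n) := by
  have := isProbabilityMeasure_betaProduct ha hb (n + 1)
  have h := integrable_const (μ := betaProduct a b (n + 1)) (1 : ℝ)
  rw [betaProduct_succ ha hb, integrable_withDensity_ofReal (measurable_betaProductDensity hb n)
    (betaProductDensity_nonneg ha hb n)] at h
  simpa using h

theorem betaProduct_real (ha : 0 < a) (hb : 0 < b) (n : ℕ) {B : Set ℝ} (hB : MeasurableSet B) :
    (betaProduct a b (n + 1)).real B = ∫ x in B, betaProductDensity a b n x := by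
  rw [Measure.real, betaProduct_succ ha hb, withDensity_apply _ hB,
    ← ofReal_integral_eq_lintegral_ofReal (integrable_betaProductDensity ha hb n).integrableOn
      (Eventually.of_forall (betaProductDensity_nonneg ha hb n)), ENNReal.toReal_ofReal]
  exact integral_nonneg (betaProductDensity_nonneg ha hb n)

/-- The density is continuous at `x`, so the distribution function is differentiable there. -/
theorem isBigO_betaProduct_cdf (ha : 0 < a) (hb : 0 < b) (n : ℕ) {x : ℝ} (hx : x ∈ Ioo (0 : ℝ) 1) :
    (fun y => (betaProduct a b (n + 1)).real (Iic y) - (betaProduct a b (n + 1)).real (Iic x))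
      =O[𝓝 x] fun y => y - x := by
  have hi := integrable_betaProductDensity ha hb n
  have hc := (continuousOn_betaProductDensity (a := a) hb n).continuousAt (isOpen_Ioo.mem_nhds hx)
  have hd : HasDerivAt (fun y => ∫ t in x..y, betaProductDensity a b n t)
      (betaProductDensity a b n x) x :=
    intervalIntegral.integral_hasDerivAt_right hi.intervalIntegrable
      (measurable_betaProductDensity hb n).stronglyMeasurable.stronglyMeasurableAtFilter hc
  have := hd.differentiableAt.isBigO_sub
  refine this.congr_left fun y => ?_
  rw [betaProduct_real ha hb n measurableSet_Iic, betaProduct_real ha hb n measurableSet_Iic,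
    intervalIntegral.integral_Iic_sub_Iic hi.integrableOn hi.integrableOn]
  simp

/-- Mellin inversion for the density of a product of independent beta variables. -/
theorem tendsto_betaProductDensity (ha : 0 < a) (hb : 0 < b) (n : ℕ) {c ω : ℝ} (hc : 1 - a < c)
    (hω : ω ∈ Ioo (0 : ℝ) 1) :
    Tendsto (fun T : ℝ => (2 * (Real.pi : ℂ) * Complex.I)⁻¹ *
      ∫ t in (-T)..T, (ω : ℂ) ^ (-((c : ℂ) + t * Complex.I)) *
        betaMoment a b ((c : ℂ) + t * Complex.I - 1) ^ (n + 1) * Complex.I) atTop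
      (𝓝 (betaProductDensity a b n ω : ℂ)) := by
  have hm := measurable_betaProductDensity (a := a) hb n
  have h0 := betaProductDensity_nonneg ha hb n
  -- The Mellin kernel is `x ^ (s - 1)`: the transform at `s` is the moment of order `s - 1`, which
  -- accounts for the abscissa `1 - a`.
  have hmom : ∀ s : ℂ, 1 - a < s.re →
      IntegrableOn (fun x : ℝ => (x : ℂ) ^ (s - 1) • (betaProductDensity a b n x : ℂ)) (Ioi 0) ∧
      mellin (fun x => (betaProductDensity a b n x : ℂ)) s = betaMoment a b (s - 1) ^ (n + 1) := by
    intro s hs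
    have h := betaProduct_moment ha hb (n + 1) (s := s - 1) (by simp; linarith)
    rw [betaProduct_succ ha hb, integrable_withDensity_ofReal hm h0,
      integral_withDensity_ofReal hm h0] at h
    have e : (fun x : ℝ => betaProductDensity a b n x • (x : ℂ) ^ (s - 1)) =
        fun x : ℝ => (x : ℂ) ^ (s - 1) • (betaProductDensity a b n x : ℂ) := by
      ext x
      rw [Complex.real_smul, smul_eq_mul, mul_comm]
    rw [e] at h
    refine ⟨h.1.integrableOn, ?_⟩
    rw [mellin, ← h.2]
    refine setIntegral_eq_integral_of_forall_compl_eq_zero fun x hx => ?_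
    have : x ∉ Ioo (0 : ℝ) 1 := fun h => hx h.1
    rw [betaProductDensity, indicator_of_notMem this]
    simp
  have h := tendsto_integral_mellin (f := fun x => (betaProductDensity a b n x : ℂ)) (c := c)
    hω.1 ?_ ?_
  · refine h.congr fun T => ?_
    congr 2
    ext t
    rw [(hmom _ (by simpa)).2]
  · refine (hmom c (by simpa)).1.congr_fun (fun x hx => ?_) measurableSet_Ioi
    dsimp only
    rw [smul_eq_mul, Complex.ofReal_cpow (le_of_lt hx)]
    push_cast
    rfl
  · refine Asymptotics.IsBigO.of_norm_left ?_
    refine (isBigO_betaProductDensity (a := a) hb n hω).norm_left.congr_left fun y => ?_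
    rw [← Complex.ofReal_sub, Complex.norm_real]

/-- The Mellin transform of a distribution function. -/
theorem mellin_cdf (μ : Measure ℝ) [IsProbabilityMeasure μ] (hμ : ∀ᵐ x ∂μ, x ∈ Ioc (0 : ℝ) 1)
    {s : ℂ} (hs : s.re < 0) (hi : Integrable (fun x : ℝ => (x : ℂ) ^ s) μ) :
    IntegrableOn (fun x : ℝ => (x : ℂ) ^ (s - 1) • (μ.real (Iic x) : ℂ)) (Ioi 0) ∧
      mellin (fun x => (μ.real (Iic x) : ℂ)) s = -(1 / s) * ∫ x, (x : ℂ) ^ s ∂μ := by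
  -- Fubini for `x ^ (s - 1)` on `y ≤ x`: integration in `y` gives `x ^ (s - 1) F(x)`, integration
  -- in `x` gives `-y ^ s / s`. The latter converges at infinity because `Re s < 0`.
  set G : ℝ × ℝ → ℂ := {z | z.2 ≤ z.1}.indicator fun z => (z.1 : ℂ) ^ (s - 1) with hG
  have hGm : Measurable G :=
    Measurable.indicator (by fun_prop) (measurableSet_le measurable_snd measurable_fst)
  have hs1 : (s - 1).re < -1 := by simp; linarith
  have hsec : ∀ y : ℝ, 0 < y → ∀ g : ℝ → ℂ, IntegrableOn g (Ioi y) →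
      IntegrableOn ((Ici y).indicator g) (Ioi 0) ∧
        ∫ x in Ioi 0, (Ici y).indicator g x = ∫ x in Ioi y, g x := by
    intro y hy g hg
    have hsub : Ioi (0 : ℝ) ∩ Ici y = Ici y := inter_eq_right.2 fun x hx => hy.trans_le hx
    constructor
    · rw [IntegrableOn, integrable_indicator_iff measurableSet_Ici, IntegrableOn,
        Measure.restrict_restrict measurableSet_Ici, inter_comm, hsub]
      exact (integrableOn_Ici_iff_integrableOn_Ioi (by simp)).2 hg
    · rw [setIntegral_indicator measurableSet_Ici, hsub, integral_Ici_eq_integral_Ioi]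
  have hGy : ∀ y : ℝ, (fun x => G (x, y)) = (Ici y).indicator fun x : ℝ => (x : ℂ) ^ (s - 1) :=
    fun y => by
      ext x
      simp [hG, indicator]
  have hGi : Integrable G ((volume.restrict (Ioi 0)).prod μ) := by
    rw [integrable_prod_iff' hGm.aestronglyMeasurable]
    constructor
    · filter_upwards [hμ] with y hy
      rw [hGy]
      exact (hsec y hy.1 _ (integrableOn_Ioi_cpow_of_lt hs1 hy.1)).1
    · have hn : (fun y : ℝ => (-1 / s.re) * ‖(y : ℂ) ^ s‖) =ᵐ[μ]
          fun y => ∫ x in Ioi 0, ‖G (x, y)‖ := by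
        filter_upwards [hμ] with y hy
        have hsub : Ioi (0 : ℝ) ∩ Ici y = Ici y := inter_eq_right.2 fun x hx => hy.1.trans_le hx
        have e : ∀ x, ‖G (x, y)‖ = (Ici y).indicator (fun x : ℝ => ‖(x : ℂ) ^ (s - 1)‖) x :=
          fun x => by
            rw [show G (x, y) = (fun x => G (x, y)) x from rfl, hGy, norm_indicator_eq_indicator_norm]
        simp_rw [e]
        rw [setIntegral_indicator measurableSet_Ici, hsub, integral_Ici_eq_integral_Ioi,
          setIntegral_congr_fun (g := fun x : ℝ => x ^ (s.re - 1)) measurableSet_Ioi,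
          integral_Ioi_rpow_of_lt (by linarith) hy.1, Complex.norm_cpow_eq_rpow_re_of_pos hy.1]
        · rw [sub_add_cancel]
          ring
        · intro x hx
          dsimp only
          rw [Complex.norm_cpow_eq_rpow_re_of_pos (hy.1.trans hx)]
          simp
      exact (hi.norm.const_mul _).congr hn
  have hGx : ∀ x : ℝ, ∫ y, G (x, y) ∂μ = (x : ℂ) ^ (s - 1) • (μ.real (Iic x) : ℂ) := fun x => by
    have e : (fun y => G (x, y)) = (Iic x).indicator fun _ : ℝ => (x : ℂ) ^ (s - 1) := by
      ext y
      simp [hG, indicator]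
    rw [e, integral_indicator measurableSet_Iic, setIntegral_const]
    simp [mul_comm]
  constructor
  · have := hGi.integral_prod_left
    simp_rw [hGx] at this
    exact this
  · rw [mellin]
    simp_rw [← hGx]
    rw [integral_integral_swap (f := fun x y => G (x, y)) hGi, ← integral_const_mul]
    refine integral_congr_ae ?_
    filter_upwards [hμ] with y hy
    rw [hGy, (hsec y hy.1 _ (integrableOn_Ioi_cpow_of_lt hs1 hy.1)).2,
      integral_Ioi_cpow_of_lt hs1 hy.1, sub_add_cancel]
    ring

/-- Mellin inversion for the distribution function of a product of independent beta variables. -/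
theorem tendsto_betaProduct_cdf (ha : 0 < a) (hb : 0 < b) (n : ℕ) {c ω : ℝ} (hc : -a < c)
    (hc0 : c < 0) (hω : ω ∈ Ioo (0 : ℝ) 1) :
    Tendsto (fun T : ℝ => (2 * (Real.pi : ℂ) * Complex.I)⁻¹ *
      ∫ t in (-T)..T, (ω : ℂ) ^ (-((c : ℂ) + t * Complex.I)) *
        (-(1 / ((c : ℂ) + t * Complex.I)) *
          betaMoment a b ((c : ℂ) + t * Complex.I) ^ (n + 1)) * Complex.I) atTop
      (𝓝 ((betaProduct a b (n + 1)).real (Iic ω) : ℂ)) := by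
  have := isProbabilityMeasure_betaProduct ha hb (n + 1)
  have hmel : ∀ s : ℂ, -a < s.re → s.re < 0 → _ := fun s hs hs0 =>
    mellin_cdf _ (ae_mem_Ioc_betaProduct ha hb (n + 1)) hs0 (betaProduct_moment ha hb (n + 1) hs).1
  have h := tendsto_integral_mellin (f := fun x => ((betaProduct a b (n + 1)).real (Iic x) : ℂ))
    (c := c) hω.1 ?_ ?_
  · refine h.congr fun T => ?_
    congr 2
    ext t
    rw [(hmel _ (by simpa) (by simpa)).2, (betaProduct_moment ha hb (n + 1) (by simpa)).2]
  · refine (hmel c (by simpa) (by simpa)).1.congr_fun (fun x hx => ?_) measurableSet_Ioi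
    dsimp only
    rw [smul_eq_mul, Complex.ofReal_cpow (le_of_lt hx)]
    push_cast
    rfl
  · refine Asymptotics.IsBigO.of_norm_left ?_
    refine (isBigO_betaProduct_cdf ha hb n hω).norm_left.congr_left fun y => ?_
    rw [← Complex.ofReal_sub, Complex.norm_real]

end

/-! ### Identification with the Meijer G-functions. -/

section

variable {ρ : ℕ}

theorem shape_pos (ρ : ℕ) : 0 < ((ρ : ℝ) + 1 / 2) / 2 := by positivity

/-- The separating line demanded by `HasMeijerG` keeps its limit clause from being vacuous, so the
value is unique. -/
theorem hasMeijerG_meijerG {m n p q : ℕ} {a : Fin p → ℂ} {b : Fin q → ℂ} {z : ℝ} {g : ℂ}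
    (h : HasMeijerG m n a b z g) :
    HasMeijerG m n a b z (meijerG m n a b z) ∧ meijerG m n a b z = g := by
  have hex : ∃ g, HasMeijerG m n a b z g := ⟨g, h⟩
  have hs : HasMeijerG m n a b z (meijerG m n a b z) := by
    rw [meijerG, dif_pos hex]
    exact hex.choose_spec
  obtain ⟨c, hc⟩ := h.1
  exact ⟨hs, tendsto_nhds_unique (hs.2 c hc) (h.2 c hc)⟩

theorem normConst_pos (ρ n : ℕ) : 0 < normConst ρ n := by
  have h1 : 0 < Real.Gamma ((2 * (ρ : ℝ) + 1 / 2) / 2) := Real.Gamma_pos_of_pos (by positivity)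
  have h2 : 0 < Real.Gamma (((ρ : ℝ) + 1 / 2) / 2) := Real.Gamma_pos_of_pos (by positivity)
  rw [normConst]
  positivity

theorem normConst_eq (ρ n : ℕ) :
    (normConst ρ n : ℂ) = (Complex.Gamma ((2 * (ρ : ℂ) + 1 / 2) / 2) /
      Complex.Gamma (((ρ : ℂ) + 1 / 2) / 2)) ^ n := by
  rw [normConst]
  push_cast
  rw [← Complex.Gamma_ofReal, ← Complex.Gamma_ofReal]
  push_cast
  rfl

/-- Here `a + b = (2ρ + 1/2)/2`, so the part of the moment free of `s` is exactly the normalising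
constant. -/
theorem betaMoment_pow (ρ n : ℕ) (s : ℂ) :
    betaMoment (((ρ : ℝ) + 1 / 2) / 2) ((ρ : ℝ) / 2) s ^ n =
      (Complex.Gamma (((ρ : ℂ) + 1 / 2) / 2 + s) /
        Complex.Gamma ((2 * (ρ : ℂ) + 1 / 2) / 2 + s)) ^ n * normConst ρ n := by
  rw [normConst_eq, ← mul_pow, betaMoment]
  push_cast
  ring_nf

/-- The parameters are `a - 1` and `a + b - 1`; the shift by one matches the moment of order `s -
1`. -/
theorem meijerIntegrand_density (ρ n : ℕ) (z : ℝ) (s : ℂ) :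
    meijerIntegrand n 0 (densityUpper ρ n) (densityLower ρ n) z s =
      (z : ℂ) ^ (-s) * (betaMoment (((ρ : ℝ) + 1 / 2) / 2) ((ρ : ℝ) / 2) (s - 1) ^ n) *
        (normConst ρ n : ℂ)⁻¹ := by
  have h0 : (normConst ρ n : ℂ) ≠ 0 := by simpa using (normConst_pos ρ n).ne'
  have h1 : (Finset.univ.filter fun j : Fin n => n ≤ j.val) = ∅ := by
    ext j; simp
  rw [betaMoment_pow, mul_assoc, mul_inv_cancel_right₀ h0, meijerIntegrand]
  simp only [densityUpper, densityLower, h1, Fin.is_lt, Finset.filter_true, zero_le, not_lt_zero,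
    Finset.filter_false, Finset.prod_const, Finset.card_univ, Fintype.card_fin, Finset.card_empty,
    pow_zero, mul_one]
  rw [div_pow]
  ring_nf

/-- The extra parameters 1 and 0 contribute `Γ(-s) / Γ(1 - s) = -1/s`, the factor that distinguishes
the transform of the distribution function. -/
theorem meijerIntegrand_cdf (ρ n : ℕ) (z : ℝ) {s : ℂ} (hs : s.re < 0) :
    meijerIntegrand n 1 (cdfUpper ρ n) (cdfLower ρ n) z s =
      (z : ℂ) ^ (-s) * (-(1 / s) * betaMoment (((ρ : ℝ) + 1 / 2) / 2) ((ρ : ℝ) / 2) s ^ n) *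
        (normConst ρ n : ℂ)⁻¹ := by
  have h0 : (normConst ρ n : ℂ) ≠ 0 := by simpa using (normConst_pos ρ n).ne'
  have hs0 : s ≠ 0 := fun h => by simp [h] at hs
  have e1 : ∏ j : Fin (n + 1) with j.val < n, Complex.Gamma (cdfLower ρ n j + s) =
      Complex.Gamma (((ρ : ℂ) + 1 / 2) / 2 + s) ^ n := by
    rw [Finset.prod_filter, Fin.prod_univ_castSucc]
    simp [cdfLower]
  have e2 : ∏ j : Fin (n + 1) with n ≤ j.val, Complex.Gamma (1 - cdfLower ρ n j - s) =
      Complex.Gamma (1 - s) := by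
    have hlt : ∀ x : Fin n, ¬n ≤ (x : ℕ) := fun x => by omega
    rw [Finset.prod_filter, Fin.prod_univ_castSucc]
    simp [cdfLower, hlt]
  have e3 : ∏ j : Fin (n + 1) with j.val < 1, Complex.Gamma (1 - cdfUpper ρ n j - s) =
      Complex.Gamma (-s) := by
    rw [Finset.prod_filter, Fin.prod_univ_succ]
    simp [cdfUpper]
  have e4 : ∏ j : Fin (n + 1) with 1 ≤ j.val, Complex.Gamma (cdfUpper ρ n j + s) =
      Complex.Gamma ((2 * (ρ : ℂ) + 1 / 2) / 2 + s) ^ n := by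
    rw [Finset.prod_filter, Fin.prod_univ_succ]
    simp [cdfUpper]
  have e5 : Complex.Gamma (1 - s) = -s * Complex.Gamma (-s) := by
    rw [← Complex.Gamma_add_one _ (neg_ne_zero.2 hs0)]
    ring_nf
  have h6 : Complex.Gamma (-s) ≠ 0 := Complex.Gamma_ne_zero_of_re_pos (by simpa)
  rw [betaMoment_pow, meijerIntegrand, e1, e2, e3, e4, e5, div_pow]
  field_simp

/-- The index `n + 1` matters: without lower parameters every `c` would separate. -/
theorem separatesPoles_density (n : ℕ) (c : ℝ) :
    SeparatesPoles (n + 1) 0 (densityUpper ρ (n + 1)) (densityLower ρ (n + 1)) c ↔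
      1 - ((ρ : ℝ) + 1 / 2) / 2 < c := by
  have e : (((ρ : ℂ) - 3 / 2) / 2).re = ((ρ : ℝ) + 1 / 2) / 2 - 1 := by
    have : (((ρ : ℂ) - 3 / 2) / 2) = ((((ρ : ℝ) + 1 / 2) / 2 - 1 : ℝ) : ℂ) := by push_cast; ring
    rw [this, Complex.ofReal_re]
  simp only [SeparatesPoles, densityLower, e, neg_sub, Fin.is_lt, not_lt_zero,
    false_imp_iff, forall_const, and_true]

theorem separatesPoles_cdf (n : ℕ) (c : ℝ) :
    SeparatesPoles (n + 1) 1 (cdfUpper ρ (n + 1)) (cdfLower ρ (n + 1)) c ↔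
      -(((ρ : ℝ) + 1 / 2) / 2) < c ∧ c < 0 := by
  rw [SeparatesPoles, Fin.forall_fin_succ', Fin.forall_fin_succ (n := n + 1)]
  simp [cdfLower, cdfUpper]
  exact fun _ => ⟨fun h => h 0 (by simp), fun h _ _ => h⟩

theorem hasMeijerG_density (hρ : 1 ≤ ρ) (n : ℕ) {ω : ℝ} (hω : ω ∈ Ioo (0 : ℝ) 1) :
    HasMeijerG (n + 1) 0 (densityUpper ρ (n + 1)) (densityLower ρ (n + 1)) ω
      ((betaProductDensity (((ρ : ℝ) + 1 / 2) / 2) ((ρ : ℝ) / 2) n ω / normConst ρ (n + 1) : ℝ)) := by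
  have hb : 0 < (ρ : ℝ) / 2 := by positivity
  refine ⟨⟨1, (separatesPoles_density n 1).2 (by linarith [shape_pos ρ])⟩, fun c hc => ?_⟩
  have h := (tendsto_betaProductDensity (shape_pos ρ) hb n ((separatesPoles_density n c).1 hc)
    hω).mul_const (normConst ρ (n + 1) : ℂ)⁻¹
  rw [Complex.ofReal_div, div_eq_mul_inv]
  refine h.congr fun T => ?_
  rw [mul_assoc, ← intervalIntegral.integral_mul_const]
  simp_rw [meijerIntegrand_density]
  congr 2
  ext t
  ring

theorem hasMeijerG_cdf (hρ : 1 ≤ ρ) (n : ℕ) {ω : ℝ} (hω : ω ∈ Ioo (0 : ℝ) 1) :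
    HasMeijerG (n + 1) 1 (cdfUpper ρ (n + 1)) (cdfLower ρ (n + 1)) ω
      (((betaProduct (((ρ : ℝ) + 1 / 2) / 2) ((ρ : ℝ) / 2) (n + 1)).real (Iic ω) /
        normConst ρ (n + 1) : ℝ)) := by
  have hb : 0 < (ρ : ℝ) / 2 := by positivity
  have ha := shape_pos ρ
  -- The midpoint of the admissible strip `-a < c < 0`.
  refine ⟨⟨-(((ρ : ℝ) + 1 / 2) / 2) / 2, (separatesPoles_cdf n _).2 ⟨by linarith, by linarith⟩⟩,
    fun c hc => ?_⟩
  obtain ⟨hc1, hc2⟩ := (separatesPoles_cdf n c).1 hc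
  have h := (tendsto_betaProduct_cdf ha hb n hc1 hc2 hω).mul_const (normConst ρ (n + 1) : ℂ)⁻¹
  rw [Complex.ofReal_div, div_eq_mul_inv]
  refine h.congr fun T => ?_
  rw [mul_assoc, ← intervalIntegral.integral_mul_const]
  congr 2
  ext t
  rw [meijerIntegrand_cdf _ _ _ (by simpa)]
  ring

theorem weightDensity_eq (hρ : 1 ≤ ρ) (n : ℕ) {ω : ℝ} (hω : ω ∈ Ioo (0 : ℝ) 1) :
    weightDensity ρ (n + 1) ω =
      betaProductDensity (((ρ : ℝ) + 1 / 2) / 2) ((ρ : ℝ) / 2) n ω := by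
  rw [weightDensity, densityG, (hasMeijerG_meijerG (hasMeijerG_density hρ n hω)).2,
    Complex.ofReal_re, mul_div_cancel₀ _ (normConst_pos _ _).ne']

theorem weightCdf_eq (hρ : 1 ≤ ρ) (n : ℕ) {ω : ℝ} (hω : ω ∈ Ioo (0 : ℝ) 1) :
    weightCdf ρ (n + 1) ω =
      (betaProduct (((ρ : ℝ) + 1 / 2) / 2) ((ρ : ℝ) / 2) (n + 1)).real (Iic ω) := by
  rw [weightCdf, cdfG, (hasMeijerG_meijerG (hasMeijerG_cdf hρ n hω)).2,
    Complex.ofReal_re, mul_div_cancel₀ _ (normConst_pos _ _).ne']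

/-- Agreement on the open interval suffices, and the G-function is identified only there. -/
theorem cdfDist_congr {F₁ F₂ G₁ G₂ : ℝ → ℝ} (h₁ : ∀ w ∈ Ioo (0 : ℝ) 1, F₁ w = G₁ w)
    (h₂ : ∀ w ∈ Ioo (0 : ℝ) 1, F₂ w = G₂ w) : cdfDist F₁ F₂ = cdfDist G₁ G₂ := by
  rw [cdfDist, cdfDist, intervalIntegral.integral_of_le zero_le_one,
    intervalIntegral.integral_of_le zero_le_one, integral_Ioc_eq_integral_Ioo,
    integral_Ioc_eq_integral_Ioo]
  congr 1
  refine setIntegral_congr_fun measurableSet_Ioo fun w hw => ?_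
  simp only [h₁ w hw, h₂ w hw]

theorem betaProduct_eq_withDensity_weightDensity (hρ : 1 ≤ ρ) (n : ℕ) :
    betaProduct (((ρ : ℝ) + 1 / 2) / 2) ((ρ : ℝ) / 2) (n + 1) =
      (volume.restrict (Ioo (0 : ℝ) 1)).withDensity
        fun ω => ENNReal.ofReal (weightDensity ρ (n + 1) ω) := by
  rw [betaProduct_succ (shape_pos ρ) (by positivity), ← withDensity_indicator measurableSet_Ioo]
  congr 1
  ext ω
  by_cases hω : ω ∈ Ioo (0 : ℝ) 1
  · rw [indicator_of_mem hω, weightDensity_eq hρ n hω]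
  · rw [indicator_of_notMem hω, betaProductDensity, indicator_of_notMem hω, ENNReal.ofReal_zero]

theorem betaProduct_real_eq_integral_weightDensity (hρ : 1 ≤ ρ) (n : ℕ) {B : Set ℝ}
    (hB : MeasurableSet B) :
    (betaProduct (((ρ : ℝ) + 1 / 2) / 2) ((ρ : ℝ) / 2) (n + 1)).real B =
      ∫ ω in B ∩ Ioo 0 1, weightDensity ρ (n + 1) ω := by
  rw [betaProduct_real (shape_pos ρ) (by positivity) n hB,
    setIntegral_congr_fun (hB.inter measurableSet_Ioo) fun ω hω => weightDensity_eq hρ n hω.2]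
  refine setIntegral_eq_of_subset_of_forall_sdiff_eq_zero hB inter_subset_left fun ω hω => ?_
  rw [betaProductDensity, indicator_of_notMem fun h => hω.2 ⟨hω.1, h⟩]

end

end ElementalWeight

end

/-! ### The main theorem. -/

theorem theorem2 {S : Type*} [MeasurableSpace S] (P : Measure S) [IsProbabilityMeasure P]
    (ρ d n₁ n₂ : ℕ) (hρ : 1 ≤ ρ) (hn₂ : 1 ≤ n₂)
    (X₁ : S → Matrix (Fin n₁) (Fin d) ℝ) (X₂ : S → Matrix (Fin n₂) (Fin d) ℝ)
    (hX₁ : ∀ i j, Measurable fun s => X₁ s i j) (hX₂ : ∀ i j, Measurable fun s => X₂ s i j)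
    (hdet : ∀ᵐ s ∂P, ((X₁ s)ᵀ * X₁ s).det ≠ 0)
    (t : Fin n₂ → S → ℝ) (ht : ∀ i s, t i s = ElementalWeight.factor (X₁ s) (X₂ s) i)
    (Ω : S → ℝ) (hΩ : ∀ s, Ω s = ElementalWeight.weight (X₁ s) (X₂ s)) :
    -- the weight is the product of its factors
    (∀ᵐ s ∂P, Ω s = ∏ i, t i s) ∧
    -- the two Meijer G-functions exist and are real on `(0, 1)`, and `σ` is a density there
    (∀ ω ∈ Ioo (0 : ℝ) 1,
      ElementalWeight.HasMeijerG n₂ 0 (ElementalWeight.densityUpper ρ n₂)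
        (ElementalWeight.densityLower ρ n₂) ω (ElementalWeight.densityG ρ n₂ ω) ∧
      (ElementalWeight.densityG ρ n₂ ω).im = 0 ∧
      ElementalWeight.HasMeijerG n₂ 1 (ElementalWeight.cdfUpper ρ n₂)
        (ElementalWeight.cdfLower ρ n₂) ω (ElementalWeight.cdfG ρ n₂ ω) ∧
      (ElementalWeight.cdfG ρ n₂ ω).im = 0 ∧
      0 ≤ ElementalWeight.weightDensity ρ n₂ ω) ∧
    IntegrableOn (ElementalWeight.weightDensity ρ n₂) (Ioo 0 1) ∧
    -- independent Beta factors: exact density and distribution function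
    (iIndepFun t P → (∀ i, P.map (t i) = ElementalWeight.factorLaw ρ) →
      P.map Ω = (volume.restrict (Ioo (0 : ℝ) 1)).withDensity
          (fun ω => ENNReal.ofReal (ElementalWeight.weightDensity ρ n₂ ω)) ∧
      ∀ ω ∈ Ioo (0 : ℝ) 1, P.real {s | Ω s ≤ ω} = ElementalWeight.weightCdf ρ n₂ ω) ∧
    -- factors whose joint law is approximately that of independent Beta variables
    (∀ ε : ℝ,
      (∀ A : Set (Fin n₂ → ℝ), MeasurableSet A →
        |P.real {s | (fun i => t i s) ∈ A} -
          (Measure.pi fun _ : Fin n₂ => ElementalWeight.factorLaw ρ).real A| ≤ ε) →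
      (∀ B : Set ℝ, MeasurableSet B →
        |P.real {s | Ω s ∈ B} -
          ∫ ω in B ∩ Ioo 0 1, ElementalWeight.weightDensity ρ n₂ ω| ≤ ε) ∧
      ∀ ω ∈ Ioo (0 : ℝ) 1,
        |P.real {s | Ω s ≤ ω} - ElementalWeight.weightCdf ρ n₂ ω| ≤ ε) ∧
    -- independent factors, each approximately Beta in the distance of distribution functions
    (iIndepFun t P →
      ElementalWeight.cdfDist (fun ω => P.real {s | Ω s ≤ ω}) (ElementalWeight.weightCdf ρ n₂) ≤
        ∑ i, ElementalWeight.cdfDist (fun w => P.real {s | t i s ≤ w})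
          (fun w => (ElementalWeight.factorLaw ρ).real (Iic w))) := by
  obtain ⟨n, rfl⟩ : ∃ n, n₂ = n + 1 := ⟨n₂ - 1, by omega⟩
  set a : ℝ := ((ρ : ℝ) + 1 / 2) / 2 with ha_def
  set b : ℝ := (ρ : ℝ) / 2 with hb_def
  have ha : 0 < a := ElementalWeight.shape_pos ρ
  have hb : 0 < b := by positivity
  have := isProbabilityMeasureBeta ha hb
  have hlaw : IsProbabilityMeasure (ElementalWeight.factorLaw ρ) := this
  have htm : ∀ i, Measurable (t i) := fun i => by
    rw [funext (ht i)]
    exact ElementalWeight.measurable_factor hX₁ hX₂ i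
  have hprod : ∀ᵐ s ∂P, Ω s = ∏ i, t i s := by
    filter_upwards [hdet] with s hs
    simp_rw [hΩ, ht]
    exact ElementalWeight.weight_eq_prod_factor _ hs
  have hmem : ∀ i, ∀ᵐ s ∂P, t i s ∈ Ioc (0 : ℝ) 1 := fun i => by
    filter_upwards [hdet] with s hs
    rw [ht]
    exact ElementalWeight.factor_mem_Ioc _ hs i
  have hvec : Measurable fun s i => t i s := measurable_pi_lambda _ htm
  have hprodm : Measurable fun x : Fin (n + 1) → ℝ => ∏ i, x i := by fun_prop
  -- No independence is used here: events for `Ω` are, almost surely, events for the vector of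
  -- factors.
  have hΩreal : ∀ B : Set ℝ, MeasurableSet B → P.real {s | Ω s ∈ B} =
      P.real {s | (fun i => t i s) ∈ (fun x : Fin (n + 1) → ℝ => ∏ i, x i) ⁻¹' B} := fun B _ => by
    refine measureReal_congr (eventuallyEq_set.2 ?_)
    filter_upwards [hprod] with s hs
    simp [hs]
  have hΩlaw : iIndepFun t P → P.map Ω = ElementalWeight.prodLaw fun i => P.map (t i) := by
    intro hind
    rw [Measure.map_congr hprod, ElementalWeight.prodLaw,
      ← (iIndepFun_iff_map_fun_eq_pi_map fun i => (htm i).aemeasurable).1 hind,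
      Measure.map_map hprodm hvec]
    rfl
  have hΩae : AEMeasurable Ω P := (hprodm.comp hvec).aemeasurable.congr
    (by filter_upwards [hprod] with s hs using hs.symm)
  have hcdf : ∀ ω, P.real {s | Ω s ≤ ω} = (P.map Ω).real (Iic ω) := fun ω => by
    rw [Measure.real, Measure.real, Measure.map_apply_of_aemeasurable hΩae measurableSet_Iic]
    rfl
  have hpi : ∀ B : Set ℝ, MeasurableSet B →
      (Measure.pi fun _ : Fin (n + 1) => ElementalWeight.factorLaw ρ).real
        ((fun x : Fin (n + 1) → ℝ => ∏ i, x i) ⁻¹' B) =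
      (ElementalWeight.betaProduct a b (n + 1)).real B := fun B hB => by
    rw [ElementalWeight.betaProduct, ElementalWeight.prodLaw, map_measureReal_apply hprodm hB]
    rfl
  refine ⟨hprod, fun ω hω => ?_, ?_, fun hind hbeta => ?_, fun ε hε => ?_, fun hind => ?_⟩
  · obtain ⟨h1, h2⟩ := ElementalWeight.hasMeijerG_meijerG
      (ElementalWeight.hasMeijerG_density hρ n hω)
    obtain ⟨h3, h4⟩ := ElementalWeight.hasMeijerG_meijerG (ElementalWeight.hasMeijerG_cdf hρ n hω)
    refine ⟨h1, ?_, h3, ?_, ?_⟩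
    · rw [ElementalWeight.densityG, h2, Complex.ofReal_im]
    · rw [ElementalWeight.cdfG, h4, Complex.ofReal_im]
    · rw [ElementalWeight.weightDensity_eq hρ n hω]
      exact ElementalWeight.betaProductDensity_nonneg ha hb n ω
  · exact (ElementalWeight.integrable_betaProductDensity ha hb n).integrableOn.congr_fun
      (fun ω hω => (ElementalWeight.weightDensity_eq hρ n hω).symm) measurableSet_Ioo
  · have hlawΩ : P.map Ω = ElementalWeight.betaProduct a b (n + 1) := by
      rw [hΩlaw hind]
      simp_rw [hbeta]
      rfl
    refine ⟨hlawΩ.trans (ElementalWeight.betaProduct_eq_withDensity_weightDensity hρ n),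
      fun ω hω => ?_⟩
    rw [hcdf, hlawΩ, ElementalWeight.weightCdf_eq hρ n hω]
  · have key : ∀ B : Set ℝ, MeasurableSet B →
        |P.real {s | Ω s ∈ B} - (ElementalWeight.betaProduct a b (n + 1)).real B| ≤ ε :=
      fun B hB => by
        rw [hΩreal B hB, ← hpi B hB]
        -- The hypothesis is applied with `A` the preimage of `B` under the product map.
        exact hε _ (hprodm hB)
    refine ⟨fun B hB => ?_, fun ω hω => ?_⟩
    · rw [← ElementalWeight.betaProduct_real_eq_integral_weightDensity hρ n hB]
      exact key B hB
    · rw [ElementalWeight.weightCdf_eq hρ n hω]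
      exact key _ measurableSet_Iic
  · have hprob : ∀ i, IsProbabilityMeasure (P.map (t i)) := fun i =>
      Measure.isProbabilityMeasure_map (htm i).aemeasurable
    have h := ElementalWeight.cdfDist_prodLaw_le (fun i => P.map (t i))
      (fun _ => ElementalWeight.factorLaw ρ)
      (fun i => (ae_map_iff (htm i).aemeasurable measurableSet_Ioc).2 (hmem i))
      (fun _ => ElementalWeight.ae_mem_Ioc_betaMeasure hb)
    rw [← hΩlaw hind] at h
    have e : ∀ i w, (P.map (t i)).real (Iic w) = P.real {s | t i s ≤ w} := fun i w => by
      rw [map_measureReal_apply (htm i) measurableSet_Iic]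
      rfl
    simp_rw [e] at h
    refine le_of_eq_of_le (ElementalWeight.cdfDist_congr (fun w _ => hcdf w) fun w hw => ?_) h
    exact ElementalWeight.weightCdf_eq hρ n hw
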